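/- **Conventions.** Seminorms take the value $\infty$ outside their domain. For a unital C*-algebra $\mathfrak A$, let $\mathfrak{sa}(\mathfrak A)$ be its self-adjoint part and $\mathscr S(\mathfrak A)$ its state space. For a seminorm $L$ on $\mathfrak{sa}(\mathfrak A)$ put $\mathsf{mk}_L(\varphi,\psi)=\sup\{|\varphi(a)-\psi(a)|: a\in\mathfrak{sa}(\mathfrak A),\ L(a)\le 1\}$ for $\varphi,\psi\in\mathscr S(\mathfrak A)$. For a function $K\ge 0$ on pairs of points, $\mathrm{Haus}_K(S,T)=\max\{\sup_{x\in S}\inf_{y\in T}K(x,y),\ \sup_{y\in T}\inf_{x\in S}K(x,y)\}$. **Quantum compact metric spaces.** $(\mathfrak A,L)$ is a *quantum compact metric space* if $L$ is a lower semicontinuous seminorm on $\mathfrak{sa}(\mathfrak A)$, finite on a dense subset, with $L(a)=0\iff a\in\mathbb R1$ and $\max\{L(\tfrac{ab+ba}2),L(\tfrac{ab-ba}{2i})\}\le\|a\|L(b)+L(a)\|b\|$, and $\mathsf{mk}_L$ is a metric inducing the weak* topology on $\mathscr S(\mathfrak A)$. A *quantum isometry* $\rho:(\mathfrak D,L)\to(\mathfrak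 A,L_{\mathfrak A})$ is a surjective unital *-morphism with $L_{\mathfrak A}(a)=\inf\{L(d):d\in\mathfrak{sa}(\mathfrak D),\ \rho(d)=a\}$ for all $a\in\mathfrak{sa}(\mathfrak A)$. A *tunnel* $\tau=(\mathfrak D,L,\rho_{\mathfrak A},\rho_{\mathfrak B})$ from $(\mathfrak A,L_{\mathfrak A})$ to $(\mathfrak B,L_{\mathfrak B})$ is a quantum compact metric space $(\mathfrak D,L)$ with quantum isometries $\rho_{\mathfrak A},\rho_{\mathfrak B}$ onto $(\mathfrak A,L_{\mathfrak A})$ and $(\mathfrak B,L_{\mathfrak B})$. Its *extent* is $$\chi(\tau)=\max\{\mathrm{Haus}_{\mathsf{mk}_L}(\mathscr S(\mathfrak D),\rho_{\mathfrak A}^*\mathscr S(\mathfrak A)),\ \mathrm{Haus}_{\mathsf{mk}_L}(\mathscr S(\mathfrak D),\rho_{\mathfrak B}^*\mathscr S(\mathfrak B))\}.$$ **Metric spectral triples.** A *spectral triple* $(\mathfrak A,\mathscr H,D)$ is a unital C*-algebra $\mathfrak A$ acting on a Hilbert space $\mathscr H$ by a unital *-representation, with a self-adjoint operator $D$ on $\mathscr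 H$ with compact resolvent, such that the set of $a\in\mathfrak A$ with $a\,\mathrm{dom}D\subseteq\mathrm{dom}D$ and $[D,a]$ bounded is dense in $\mathfrak A$. Put $L_D(a)=\|[D,a]\|$ for such self-adjoint $a$ ($\infty$ for other self-adjoint $a$) and $\mathsf{DN}_D(\xi)=\|\xi\|+\|D\xi\|$ ($\infty$ off $\mathrm{dom}D$). The triple is *metric* if $\mathsf{mk}_{L_D}$ is a metric inducing the weak* topology on $\mathscr S(\mathfrak A)$. **Spectral propinquity.** A *metrical tunnel* $\tau$ from $(\mathfrak A,\mathscr H_{\mathfrak A},D_{\mathfrak A})$ to $(\mathfrak B,\mathscr H_{\mathfrak B},D_{\mathfrak B})$ consists of * quantum compact metric spaces $(\mathfrak D,L)$, $(\mathfrak E,L_{\mathfrak E})$, and a $\mathfrak D$-$\mathfrak E$ C*-correspondence $E$ (a right Hilbert $\mathfrak E$-module with a unital left action of $\mathfrak D$ by adjointable operators); * a norm $\mathsf{TN}$ on a dense subspace of $E$ with $\|\omega\|\le\mathsf{TN}(\omega)$, $\{\mathsf{TN}\le1\}$ compact, $\mathsf{TN}(d\omega)\le(\|d\|+L(d))\mathsf{TN}(\omega)$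 for $d\in\mathfrak{sa}(\mathfrak D)$, and $\max\{L_{\mathfrak E}(\mathrm{Re}\langle\omega,\omega'\rangle),L_{\mathfrak E}(\mathrm{Im}\langle\omega,\omega'\rangle)\}\le2\,\mathsf{TN}(\omega)\mathsf{TN}(\omega')$; * for each $\mathfrak X\in\{\mathfrak A,\mathfrak B\}$, quantum isometries $\rho_{\mathfrak X}:(\mathfrak D,L)\to(\mathfrak X,L_{D_{\mathfrak X}})$ and $\pi_{\mathfrak X}:(\mathfrak E,L_{\mathfrak E})\to(\mathbb C,0)$ and a linear surjection $\Pi_{\mathfrak X}:E\to\mathscr H_{\mathfrak X}$ with $\Pi_{\mathfrak X}(d\,\omega\,e)=\pi_{\mathfrak X}(e)\,\rho_{\mathfrak X}(d)\Pi_{\mathfrak X}(\omega)$, $\langle\Pi_{\mathfrak X}\omega,\Pi_{\mathfrak X}\omega'\rangle=\pi_{\mathfrak X}(\langle\omega,\omega'\rangle)$ and $\mathsf{DN}_{D_{\mathfrak X}}(\xi)=\inf\{\mathsf{TN}(\omega):\Pi_{\mathfrak X}\omega=\xi\}$. Its extent $\chi(\tau)$ is the maximum of the extents of the tunnels $(\mathfrak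 D,L,\rho_{\mathfrak A},\rho_{\mathfrak B})$ and $(\mathfrak E,L_{\mathfrak E},\pi_{\mathfrak A},\pi_{\mathfrak B})$. For $\varepsilon>0$, its $\varepsilon$-separation is $\mathrm{sep}(\tau|\varepsilon)=\mathrm{Haus}_{K_\varepsilon}(\{\mathsf{DN}_{D_{\mathfrak A}}\le1\},\{\mathsf{DN}_{D_{\mathfrak B}}\le1\})$, where $$K_\varepsilon(\xi,\eta)=\sup_{0\le s\le1/\varepsilon,\ \mathsf{TN}(\omega)\le1}\big|\langle e^{isD_{\mathfrak A}}\xi,\Pi_{\mathfrak A}\omega\rangle-\langle e^{isD_{\mathfrak B}}\eta,\Pi_{\mathfrak B}\omega\rangle\big|.$$ The *spectral propinquity* is $$\Lambda^{\mathsf{spec}}((\mathfrak A,\mathscr H_{\mathfrak A},D_{\mathfrak A}),(\mathfrak B,\mathscr H_{\mathfrak B},D_{\mathfrak B}))=\inf\{\varepsilon>0:\ \text{there is a metrical tunnel }\tau\text{ with }\max\{\chi(\tau),\mathrm{sep}(\tau|\varepsilon)\}<\varepsilon\}.$$ **Theorem.** Let $\mathfrak A$ be a unital separable C*-algebra acting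 on a Hilbert space $\mathscr H$, and for each $t\in[0,1]$ let $(\mathfrak A,\mathscr H,D_t)$ be a metric spectral triple; write $L_t=L_{D_t}$. Assume: 1. for every $\varepsilon>0$ there is $\delta>0$ such that for all $t\in[0,1]$ with $t<\delta$, $(\mathfrak A\oplus\mathfrak A,\mathsf T,j_1,j_2)$ is a tunnel from $(\mathfrak A,L_0)$ to $(\mathfrak A,L_t)$, where $j_1,j_2$ are the projections on the first and second summands and $\mathsf T(a,b)=\max\{L_0(a),L_t(b),\tfrac2\varepsilon\|a-b\|\}$; 2. there are continuous functions $\lambda_n:[0,1]\to\mathbb R$ and $e_n:[0,1]\to\mathscr H$ ($n\in\mathbb N$) such that (a) $(e_n(t))_{n\in\mathbb N}$ is a Hilbert basis (orthonormal basis) of $\mathscr H$ for every $t\in[0,1]$; (b) $e_n(t)\in\mathrm{dom}D_t$ and $D_te_n(t)=\lambda_n(t)e_n(t)$ for all $n$ and $t$; (c) for every $\Lambda>0$ there is $\delta>0$ such that for all $t\in[0,1]$ with $t<\delta$, the sets $\mathrm{Sp}(D_t)\cap[-\Lambda,\Lambda]$ and $\mathrm{Sp}(D_0)\cap[-\Lambda,\Lambda]$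 have the same number of elements. Then $\displaystyle\lim_{t\to0}\Lambda^{\mathsf{spec}}((\mathfrak A,\mathscr H,D_t),(\mathfrak A,\mathscr H,D_0))=0$. -/

import Mathlib

open Filter Topology
open scoped ENNReal NNReal

universe u v

noncomputable section

/-! ### States and quantum compact metric spaces -/

/-- The state space of a unital C*-algebra: the positive unital linear functionals, as a subset of
the dual. The coerced type carries the weak* topology. -/
def stateSpace (A : Type*) [CStarAlgebra A] : Set (WeakDual ℂ A) :=
  {φ | φ 1 = 1 ∧ ∀ a : A, 0 ≤ (φ (star a * a)).re ∧ (φ (star a * a)).im = 0}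

/-- The pull-back `ψ ↦ ψ ∘ ρ` of states along a unital *-morphism `ρ`. -/
def statePullback {A B : Type*} [CStarAlgebra A] [CStarAlgebra B] (ρ : A →⋆ₐ[ℂ] B)
    (ψ : stateSpace B) : stateSpace A :=
  ⟨StrongDual.toWeakDual ((WeakDual.toStrongDual ψ.1).comp
      ⟨ρ.toAlgHom.toLinearMap, (NonUnitalStarAlgHom.instContinuousLinearMapClassComplex
        (F := A →⋆ₐ[ℂ] B) (A := A) (B := B)).map_continuous ρ⟩), by
    constructor
    · change ψ.1 (ρ 1) = 1
      rw [map_one]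
      exact ψ.2.1
    · intro a
      change 0 ≤ (ψ.1 (ρ (star a * a))).re ∧ (ψ.1 (ρ (star a * a))).im = 0
      rw [map_mul, map_star]
      exact ψ.2.2 (ρ a)⟩

/-- The Monge–Kantorovich metric of a seminorm `L` on the self-adjoint part, where `L` takes the
value `∞` outside its domain. -/
def mongeKantorovich {A : Type*} [CStarAlgebra A] (L : selfAdjoint A → ℝ≥0∞)
    (φ ψ : stateSpace A) : ℝ≥0∞ :=
  ⨆ (a : selfAdjoint A) (_ : L a ≤ 1), ‖φ.1 (a : A) - ψ.1 (a : A)‖ₑ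

/-- The Monge–Kantorovich metric is a (finite) metric inducing the weak* topology on the states. -/
structure MetrizesWeakStar {A : Type*} [CStarAlgebra A] (L : selfAdjoint A → ℝ≥0∞) : Prop where
  finite : ∀ φ ψ : stateSpace A, mongeKantorovich L φ ψ < ∞
  nhds_hasBasis : ∀ φ : stateSpace A,
    (𝓝 φ).HasBasis (fun r : ℝ≥0∞ => 0 < r) (fun r => {ψ | mongeKantorovich L φ ψ < r})

/-- `(A, L)` is a quantum compact metric space. For self-adjoint `a, b`, the Jordan product
`(ab + ba) / 2` is the real part of `ab`, the Lie product `(ab - ba) / 2i` is its imaginary part. -/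
structure IsQuantumCompactMetricSpace {A : Type*} [CStarAlgebra A]
    (L : selfAdjoint A → ℝ≥0∞) : Prop where
  add_le : ∀ a b, L (a + b) ≤ L a + L b
  smul : ∀ (r : ℝ) (a), L (r • a) = ‖r‖ₑ * L a
  dense_dom : Dense {a | L a < ∞}
  eq_zero_iff : ∀ a, L a = 0 ↔ ∃ r : ℝ, a = r • (1 : selfAdjoint A)
  lsc : LowerSemicontinuous L
  leibniz_jordan : ∀ a b : selfAdjoint A,
    L (realPart ((a : A) * b)) ≤ ‖(a : A)‖ₑ * L b + L a * ‖(b : A)‖ₑ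
  leibniz_lie : ∀ a b : selfAdjoint A,
    L (imaginaryPart ((a : A) * b)) ≤ ‖(a : A)‖ₑ * L b + L a * ‖(b : A)‖ₑ
  metrizes : MetrizesWeakStar L

/-- A quantum isometry: a surjective unital *-morphism `ρ` such that the seminorm of the target is
the quotient of the seminorm of the source. -/
structure IsQuantumIsometry {A B : Type*} [CStarAlgebra A] [CStarAlgebra B]
    (LA : selfAdjoint A → ℝ≥0∞) (LB : selfAdjoint B → ℝ≥0∞) (ρ : A →⋆ₐ[ℂ] B) : Prop where
  surjective : Function.Surjective ρ
  quotient : ∀ b : selfAdjoint B,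
    LB b = ⨅ (a : selfAdjoint A) (_ : ρ (a : A) = (b : B)), LA a

/-! ### Tunnels and their extent -/

/-- `(𝔇, L, ρA, ρB)` is a tunnel from `(A, LA)` to `(B, LB)`. -/
structure IsTunnel {𝔇 A B : Type*} [CStarAlgebra 𝔇] [CStarAlgebra A] [CStarAlgebra B]
    (L : selfAdjoint 𝔇 → ℝ≥0∞) (LA : selfAdjoint A → ℝ≥0∞) (LB : selfAdjoint B → ℝ≥0∞)
    (ρA : 𝔇 →⋆ₐ[ℂ] A) (ρB : 𝔇 →⋆ₐ[ℂ] B) : Prop where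
  qcms : IsQuantumCompactMetricSpace L
  left : IsQuantumIsometry L LA ρA
  right : IsQuantumIsometry L LB ρB

/-- The Hausdorff distance of two sets for a distance function `K` between their points. -/
def hausdorffDistance {X Y : Type*} (K : X → Y → ℝ≥0∞) (S : Set X) (T : Set Y) : ℝ≥0∞ :=
  max (⨆ x ∈ S, ⨅ y ∈ T, K x y) (⨆ y ∈ T, ⨅ x ∈ S, K x y)

/-- The extent of the tunnel `(𝔇, L, ρA, ρB)`. -/
def tunnelExtent {𝔇 A B : Type*} [CStarAlgebra 𝔇] [CStarAlgebra A] [CStarAlgebra B]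
    (L : selfAdjoint 𝔇 → ℝ≥0∞) (ρA : 𝔇 →⋆ₐ[ℂ] A) (ρB : 𝔇 →⋆ₐ[ℂ] B) : ℝ≥0∞ :=
  max (hausdorffDistance (mongeKantorovich L) Set.univ (Set.range (statePullback ρA)))
    (hausdorffDistance (mongeKantorovich L) Set.univ (Set.range (statePullback ρB)))

/-- The seminorm `(a, b) ↦ max (LA a, LB b, (2 / ε) ‖a - b‖)` on `A ⊕ A`. -/
def directSumSeminorm {A : Type*} [CStarAlgebra A] (LA LB : selfAdjoint A → ℝ≥0∞) (ε : ℝ)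
    (c : selfAdjoint (A × A)) : ℝ≥0∞ :=
  max (max (LA ⟨(c : A × A).1, congrArg Prod.fst (selfAdjoint.mem_iff.mp c.2)⟩)
      (LB ⟨(c : A × A).2, congrArg Prod.snd (selfAdjoint.mem_iff.mp c.2)⟩))
    (ENNReal.ofReal (2 / ε * ‖(c : A × A).1 - (c : A × A).2‖))

/-! ### Unbounded operators -/

section Unbounded

variable {H : Type*} [NormedAddCommGroup H] [InnerProductSpace ℂ H]

/-- `R` is the bounded inverse of `D - z`. -/
def IsResolventAt (D : H →ₗ.[ℂ] H) (z : ℂ) (R : H →L[ℂ] H) : Prop :=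
  (∀ x : H, ∃ h : R x ∈ D.domain, D ⟨R x, h⟩ - z • R x = x) ∧
    ∀ x : D.domain, R (D x - z • (x : H)) = x

/-- The spectrum of a (possibly unbounded) operator. -/
def unboundedSpectrum (D : H →ₗ.[ℂ] H) : Set ℂ :=
  {z | ¬ ∃ R : H →L[ℂ] H, IsResolventAt D z R}

/-- The graph norm `ξ ↦ ‖ξ‖ + ‖D ξ‖`, with value `∞` outside the domain of `D`. -/
def graphNorm (D : H →ₗ.[ℂ] H) (ξ : H) : ℝ≥0∞ :=
  ⨅ h : ξ ∈ D.domain, ‖ξ‖ₑ + ‖D ⟨ξ, h⟩‖ₑ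

/-- `U` is a strongly continuous one-parameter unitary group with `U'(0) ξ = i D ξ` for `ξ` in the
domain of `D`. As a self-adjoint operator has no proper symmetric extension, for self-adjoint `D`
this says that `i D` is exactly the generator of `U`. -/
structure IsUnitaryGroupOf [CompleteSpace H] (D : H →ₗ.[ℂ] H) (U : ℝ → H →L[ℂ] H) : Prop where
  unitary_mem : ∀ s, U s ∈ unitary (H →L[ℂ] H)
  map_zero : U 0 = 1
  map_add : ∀ r s, U (r + s) = U r * U s
  continuous_apply : ∀ ξ : H, Continuous fun s => U s ξ
  hasDerivAt : ∀ ξ : D.domain, HasDerivAt (fun s : ℝ => U s (ξ : H)) (Complex.I • D ξ) 0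

theorem IsUnitaryGroupOf.inner_neg [CompleteSpace H] {D : H →ₗ.[ℂ] H} {U : ℝ → H →L[ℂ] H}
    (hU : IsUnitaryGroupOf D U) (s : ℝ) (x y : H) :
    inner ℂ (U s x) y = inner ℂ x (U (-s) y) := by
  have h1 : star (U s) * U s = 1 := (Unitary.mem_iff.mp (hU.unitary_mem s)).1
  have h2 : U s * U (-s) = 1 := by rw [← hU.map_add, add_neg_cancel, hU.map_zero]
  have h3 : star (U s) = U (-s) := left_inv_eq_right_inv h1 h2
  rw [← h3, ContinuousLinearMap.star_eq_adjoint, ContinuousLinearMap.adjoint_inner_right]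

theorem IsUnitaryGroupOf.hasDerivAt_apply [CompleteSpace H] {D : H →ₗ.[ℂ] H}
    {U : ℝ → H →L[ℂ] H} (hU : IsUnitaryGroupOf D U) (ξ : D.domain) (s : ℝ) :
    HasDerivAt (fun r : ℝ => U r (ξ : H)) (U s (Complex.I • D ξ)) s := by
  have h0 : HasDerivAt (fun r : ℝ => U r (ξ : H)) (Complex.I • D ξ) (s - s) := by
    simpa using hU.hasDerivAt ξ
  have h1 := HasDerivAt.comp_sub_const s s h0
  have h2 := ((U s).restrictScalars ℝ).hasFDerivAt.comp_hasDerivAt s h1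
  refine h2.congr_of_eventuallyEq (Filter.Eventually.of_forall fun r => ?_)
  have : U r = U s * U (r - s) := by rw [← hU.map_add]; congr 1; ring
  simp [this]

theorem IsUnitaryGroupOf.apply_mem [CompleteSpace H] {D : H →ₗ.[ℂ] H} (hD : IsSelfAdjoint D)
    {U : ℝ → H →L[ℂ] H} (hU : IsUnitaryGroupOf D U) (ξ : D.domain) (s : ℝ) :
    ∃ h : U s ξ ∈ D.domain, D ⟨U s ξ, h⟩ = U s (D ξ) := by
  have hdense := hD.dense_domain
  have key : ∀ η : D.domain, inner ℂ (U s (D ξ)) (η : H) = inner ℂ (U s (ξ : H)) (D η) := by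
    intro η
    have e1 : HasDerivAt (fun r : ℝ => inner ℂ (U s (ξ : H)) (U r (η : H)))
        (inner ℂ (U s (ξ : H)) (Complex.I • D η)) 0 := by
      exact ((hasDerivAt_const (0 : ℝ) (U s (ξ : H))).inner ℂ (hU.hasDerivAt η)).congr_deriv
        (by rw [inner_zero_left, add_zero])
    have e2 : HasDerivAt (fun r : ℝ => inner ℂ (U (s - r) (ξ : H)) (η : H))
        (inner ℂ (-(U s (Complex.I • D ξ))) (η : H)) 0 := by
      have h0 : HasDerivAt (fun r : ℝ => U r (ξ : H)) (U s (Complex.I • D ξ)) (s - 0) := by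
        simpa using hU.hasDerivAt_apply ξ s
      have h1 := HasDerivAt.comp_const_sub s 0 h0
      simpa using h1.inner ℂ (hasDerivAt_const (0 : ℝ) (η : H))
    have e3 : (fun r : ℝ => inner ℂ (U (s - r) (ξ : H)) (η : H)) =
        fun r : ℝ => inner ℂ (U s (ξ : H)) (U r (η : H)) := by
      funext r
      have : U (s - r) = U (-r) * U s := by rw [← hU.map_add]; congr 1; ring
      rw [this, mul_apply_eq_comp, hU.inner_neg, neg_neg]
    rw [e3] at e2
    have e4 := e2.unique e1
    rw [map_smul, inner_neg_left, inner_smul_left, inner_smul_right, Complex.conj_I] at e4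
    have : Complex.I * inner ℂ (U s (D ξ)) (η : H) =
        Complex.I * inner ℂ (U s (ξ : H)) (D η) := by rw [← e4]; ring
    exact mul_left_cancel₀ Complex.I_ne_zero this
  have hadj : D.adjoint = D := LinearPMap.isSelfAdjoint_def.mp hD
  have hm : U s ξ ∈ D.adjoint.domain := LinearPMap.mem_adjoint_domain_of_exists _ ⟨_, key⟩
  have hv : D.adjoint ⟨U s ξ, hm⟩ = U s (D ξ) := LinearPMap.adjoint_apply_eq hdense _ key
  revert hm
  rw [hadj]
  intro hm hv
  exact ⟨hm, hv⟩

/-- A self-adjoint operator generates at most one unitary group. -/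
theorem IsUnitaryGroupOf.unique [CompleteSpace H] {D : H →ₗ.[ℂ] H} (hD : IsSelfAdjoint D)
    {U V : ℝ → H →L[ℂ] H} (hU : IsUnitaryGroupOf D U) (hV : IsUnitaryGroupOf D V) : U = V := by
  have hdense := hD.dense_domain
  have hsym : ∀ x y : D.domain, inner ℂ (D x) (y : H) = inner ℂ (x : H) (D y) := by
    have h := LinearPMap.adjoint_isFormalAdjoint hdense
    rw [LinearPMap.isSelfAdjoint_def.mp hD] at h
    exact h
  have main : ∀ (ξ η : D.domain) (s : ℝ),
      inner ℂ (V s (η : H)) (U s (ξ : H)) = inner ℂ (η : H) (ξ : H) := by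
    intro ξ η s
    have hd : ∀ r : ℝ, HasDerivAt (fun r : ℝ => inner ℂ (V r (η : H)) (U r (ξ : H))) 0 r := by
      intro r
      have h := (hV.hasDerivAt_apply η r).inner ℂ (hU.hasDerivAt_apply ξ r)
      obtain ⟨m1, w1⟩ := hU.apply_mem hD ξ r
      obtain ⟨m2, w2⟩ := hV.apply_mem hD η r
      have hs := hsym ⟨_, m2⟩ ⟨_, m1⟩
      rw [w1, w2] at hs
      refine h.congr_deriv ?_
      rw [map_smul, map_smul, inner_smul_left, inner_smul_right, hs, Complex.conj_I]
      ring
    have := is_const_of_deriv_eq_zero (fun r => (hd r).differentiableAt)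
      (fun r => (hd r).deriv) s 0
    simpa [hU.map_zero, hV.map_zero] using this
  funext s
  have hcont : ∀ ξ : D.domain, U s (ξ : H) = V s (ξ : H) := by
    intro ξ
    have h1 : ∀ η : D.domain, inner ℂ (η : H) (V (-s) (U s (ξ : H))) = inner ℂ (η : H) (ξ : H) :=
      fun η => by rw [← hV.inner_neg, main]
    have h2 : V (-s) (U s (ξ : H)) = ξ :=
      hdense.eq_of_inner_right ℂ fun v hv => h1 ⟨v, hv⟩
    have h3 : V s * V (-s) = 1 := by rw [← hV.map_add, add_neg_cancel, hV.map_zero]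
    calc U s (ξ : H) = (V s * V (-s)) (U s (ξ : H)) := by rw [h3]; rfl
      _ = V s (ξ : H) := by rw [mul_apply_eq_comp, h2]
  exact ContinuousLinearMap.ext fun x => congrFun
    (Continuous.ext_on hdense (U s).continuous (V s).continuous fun y hy => hcont ⟨y, hy⟩) x

/-- The group `s ↦ exp (i s D)` of a self-adjoint operator `D`. It exists by Stone's theorem, and
it is unique by `IsUnitaryGroupOf.unique`. -/
def expI [CompleteSpace H] (D : H →ₗ.[ℂ] H) : ℝ → H →L[ℂ] H :=
  open Classical in if h : ∃ U, IsUnitaryGroupOf D U then h.choose else fun _ => 1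

end Unbounded

/-! ### Spectral triples -/

section SpectralTriple

variable {A : Type*} [CStarAlgebra A] {H : Type*} [NormedAddCommGroup H] [InnerProductSpace ℂ H]
  [CompleteSpace H]

/-- The operator norm of the commutator `[D, a]`; it is `∞` unless `a` maps the domain of `D` to
itself and `[D, a]` is bounded there. -/
def commutatorNorm (π : A →⋆ₐ[ℂ] (H →L[ℂ] H)) (D : H →ₗ.[ℂ] H) (a : A) : ℝ≥0∞ :=
  ⨅ (C : ℝ≥0) (_ : ∀ ξ : D.domain, ∃ h : π a ξ ∈ D.domain,
    ‖D ⟨π a ξ, h⟩ - π a (D ξ)‖ ≤ C * ‖(ξ : H)‖), (C : ℝ≥0∞)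

/-- The seminorm `a ↦ ‖[D, a]‖` on the self-adjoint part. -/
def diracSeminorm (π : A →⋆ₐ[ℂ] (H →L[ℂ] H)) (D : H →ₗ.[ℂ] H) (a : selfAdjoint A) : ℝ≥0∞ :=
  commutatorNorm π D a

/-- `(A, H, D)` is a spectral triple, where `A` acts on `H` by `π`. -/
structure IsSpectralTriple (π : A →⋆ₐ[ℂ] (H →L[ℂ] H)) (D : H →ₗ.[ℂ] H) : Prop where
  isSelfAdjoint : IsSelfAdjoint D
  compact_resolvent : ∃ z R, IsResolventAt D z R ∧ IsCompactOperator R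
  dense_smooth : Dense {a : A | commutatorNorm π D a < ∞}

/-- A metric spectral triple: the metric of Connes induces the weak* topology on the states. -/
structure IsMetricSpectralTriple (π : A →⋆ₐ[ℂ] (H →L[ℂ] H)) (D : H →ₗ.[ℂ] H) : Prop
    extends IsSpectralTriple π D where
  metrizes : MetrizesWeakStar (diracSeminorm π D)

end SpectralTriple

/-! ### Metrical C*-correspondences and metrical tunnels -/

/-- A `𝔇`-`𝔈`-C*-correspondence: a right Hilbert C*-module `E` over `𝔈` (with the inner product
linear in the second variable) with a unital left action of `𝔇` by adjointable operators.
(The module laws of the right action follow from `inner_rsmul_right` and `norm_sq`.) -/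
structure CStarCorrespondence (𝔇 𝔈 E : Type*) [CStarAlgebra 𝔇] [CStarAlgebra 𝔈]
    [NormedAddCommGroup E] [NormedSpace ℂ E] where
  act : 𝔇 →ₐ[ℂ] Module.End ℂ E
  rsmul : E → 𝔈 → E
  inn : E → E → 𝔈
  inner_add_right : ∀ x y z, inn x (y + z) = inn x y + inn x z
  inner_smul_right : ∀ x (c : ℂ) y, inn x (c • y) = c • inn x y
  inner_rsmul_right : ∀ x y e, inn x (rsmul y e) = inn x y * e
  star_inner : ∀ x y, star (inn x y) = inn y x
  inner_self_pos : ∀ x, ∃ e : 𝔈, inn x x = star e * e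
  norm_sq : ∀ x, ‖x‖ ^ 2 = ‖inn x x‖
  act_adjoint : ∀ a x y, inn (act a x) y = inn x (act (star a) y)

/-- A metrical C*-correspondence: `TN` (with value `∞` outside its domain) is a D-norm. -/
structure IsMetricalCorrespondence {𝔇 𝔈 E : Type*} [CStarAlgebra 𝔇] [CStarAlgebra 𝔈]
    [NormedAddCommGroup E] [NormedSpace ℂ E] (M : CStarCorrespondence 𝔇 𝔈 E)
    (TN : E → ℝ≥0∞) (LD : selfAdjoint 𝔇 → ℝ≥0∞) (LE : selfAdjoint 𝔈 → ℝ≥0∞) : Prop where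
  qcms_left : IsQuantumCompactMetricSpace LD
  qcms_base : IsQuantumCompactMetricSpace LE
  add_le : ∀ x y, TN (x + y) ≤ TN x + TN y
  smul : ∀ (c : ℂ) x, TN (c • x) = ‖c‖ₑ * TN x
  dense_dom : Dense {x | TN x < ∞}
  norm_le : ∀ x, ‖x‖ₑ ≤ TN x
  isCompact_ball : IsCompact {x | TN x ≤ 1}
  inner_leibniz_re : ∀ x y, LE (realPart (M.inn x y)) ≤ 2 * TN x * TN y
  inner_leibniz_im : ∀ x y, LE (imaginaryPart (M.inn x y)) ≤ 2 * TN x * TN y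
  modular_leibniz : ∀ (a : selfAdjoint 𝔇) x, TN (M.act a x) ≤ (‖(a : 𝔇)‖ₑ + LD a) * TN x

/-- `(ρ, Π, j)` is a metrical quantum isometry from a metrical C*-correspondence onto the metrical
C*-correspondence `(H, graph norm of D, A, ‖[D, ·]‖, ℂ, 0)` of a metric spectral triple. -/
structure IsMetricalIsometry {𝔇 𝔈 E A H : Type*} [CStarAlgebra 𝔇] [CStarAlgebra 𝔈]
    [NormedAddCommGroup E] [NormedSpace ℂ E] [CStarAlgebra A] [NormedAddCommGroup H]
    [InnerProductSpace ℂ H] [CompleteSpace H] (M : CStarCorrespondence 𝔇 𝔈 E)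
    (TN : E → ℝ≥0∞) (LD : selfAdjoint 𝔇 → ℝ≥0∞) (LE : selfAdjoint 𝔈 → ℝ≥0∞)
    (π : A →⋆ₐ[ℂ] (H →L[ℂ] H)) (D : H →ₗ.[ℂ] H)
    (ρ : 𝔇 →⋆ₐ[ℂ] A) (P : E →ₗ[ℂ] H) (j : 𝔈 →⋆ₐ[ℂ] ℂ) : Prop where
  left : IsQuantumIsometry LD (diracSeminorm π D) ρ
  base : IsQuantumIsometry LE (fun _ => 0) j
  surjective : Function.Surjective P
  map_act : ∀ a x, P (M.act a x) = π (ρ a) (P x)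
  map_rsmul : ∀ x e, P (M.rsmul x e) = j e • P x
  map_inner : ∀ x y, inner ℂ (P x) (P y) = j (M.inn x y)
  quotient : ∀ ξ : H, graphNorm D ξ = ⨅ (x : E) (_ : P x = ξ), TN x

section Propinquity

variable {A B : Type u} [CStarAlgebra A] [CStarAlgebra B]
  {HA HB : Type v} [NormedAddCommGroup HA] [InnerProductSpace ℂ HA] [CompleteSpace HA]
  [NormedAddCommGroup HB] [InnerProductSpace ℂ HB] [CompleteSpace HB]

/-- A metrical tunnel from `(A, HA, DA)` to `(B, HB, DB)`. (Quantum compact metric spaces are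
separable, so the choice of the universes for the C*-algebras and the module is immaterial.) -/
structure MetricalTunnel (πA : A →⋆ₐ[ℂ] (HA →L[ℂ] HA)) (DA : HA →ₗ.[ℂ] HA)
    (πB : B →⋆ₐ[ℂ] (HB →L[ℂ] HB)) (DB : HB →ₗ.[ℂ] HB) where
  𝔇 : Type u
  𝔈 : Type
  E : Type v
  [cstar_𝔇 : CStarAlgebra 𝔇]
  [cstar_𝔈 : CStarAlgebra 𝔈]
  [normed_E : NormedAddCommGroup E]
  [space_E : NormedSpace ℂ E]
  [complete_E : CompleteSpace E]
  M : CStarCorrespondence 𝔇 𝔈 E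
  TN : E → ℝ≥0∞
  LD : selfAdjoint 𝔇 → ℝ≥0∞
  LE : selfAdjoint 𝔈 → ℝ≥0∞
  isMetrical : IsMetricalCorrespondence M TN LD LE
  ρA : 𝔇 →⋆ₐ[ℂ] A
  ρB : 𝔇 →⋆ₐ[ℂ] B
  PA : E →ₗ[ℂ] HA
  PB : E →ₗ[ℂ] HB
  jA : 𝔈 →⋆ₐ[ℂ] ℂ
  jB : 𝔈 →⋆ₐ[ℂ] ℂ
  isometry_left : IsMetricalIsometry M TN LD LE πA DA ρA PA jA
  isometry_right : IsMetricalIsometry M TN LD LE πB DB ρB PB jB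

attribute [instance] MetricalTunnel.cstar_𝔇 MetricalTunnel.cstar_𝔈 MetricalTunnel.normed_E
  MetricalTunnel.space_E MetricalTunnel.complete_E

variable {πA : A →⋆ₐ[ℂ] (HA →L[ℂ] HA)} {DA : HA →ₗ.[ℂ] HA}
  {πB : B →⋆ₐ[ℂ] (HB →L[ℂ] HB)} {DB : HB →ₗ.[ℂ] HB}

/-- The extent of a metrical tunnel: the maximum of the extents of the tunnel from `A` to `B` and
of the tunnel from `ℂ` to `ℂ` that it contains. -/
def MetricalTunnel.extent (τ : MetricalTunnel πA DA πB DB) : ℝ≥0∞ :=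
  max (tunnelExtent τ.LD τ.ρA τ.ρB) (tunnelExtent τ.LE τ.jA τ.jB)

/-- The quantity `K_ε (ξ, η)` that compares the orbits of two vectors through a metrical tunnel. -/
def MetricalTunnel.orbitDistance (τ : MetricalTunnel πA DA πB DB) (ε : ℝ≥0) (ξ : HA) (η : HB) :
    ℝ≥0∞ :=
  ⨆ (s : ℝ) (_ : 0 ≤ s ∧ s ≤ 1 / ε) (ω : τ.E) (_ : τ.TN ω ≤ 1),
    ‖inner ℂ (expI DA s ξ) (τ.PA ω) - inner ℂ (expI DB s η) (τ.PB ω)‖ₑ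

/-- The `ε`-separation of a metrical tunnel, for the unitary groups of the Dirac operators. -/
def MetricalTunnel.separation (τ : MetricalTunnel πA DA πB DB) (ε : ℝ≥0) : ℝ≥0∞ :=
  hausdorffDistance (τ.orbitDistance ε) {ξ | graphNorm DA ξ ≤ 1} {η | graphNorm DB η ≤ 1}

variable (πA DA πB DB) in
/-- The spectral propinquity between `(A, HA, DA)` and `(B, HB, DB)`. -/
def spectralPropinquity : ℝ≥0∞ :=
  ⨅ (ε : ℝ≥0) (_ : 0 < ε ∧ ∃ τ : MetricalTunnel πA DA πB DB,
    max τ.extent (τ.separation ε) < ε), (ε : ℝ≥0∞)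

end Propinquity

end

/-! All three layers of the metrical tunnel are direct sums: `A × A`, `ℂ × ℂ` and `H × H`, with
seminorms and D-norm of the form max(first, second, (2/ε)‖difference‖). The first hypothesis makes
`A × A` a tunnel; its extent is at most ε/2, because a state φ can be replaced by its composition
with either copy of the diagonal at the cost of ‖a - b‖ ≤ ε/2. The same argument serves `ℂ × ℂ`.

Everything else rests on one estimate, `OrbitApprox`, needed in both directions between `D 0` and `D
t`: each ξ has a partner η of no larger graph norm whose orbit stays close to that of ξ up to time
1/ε. At time zero it lets ξ be lifted to (ξ, η) without raising the D-norm, so the coordinate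
projections of `H × H` are isometries for the D-norms. At all times it bounds the separation.

The partner comes from `IsEigenbasis.exists_approx`: cut the eigenexpansion of ξ down to a finite
index set F, at a cost of at most ‖Dξ‖/Λ if all eigenvalues off F have modulus at least Λ; move the
coefficients to the other eigenbasis; shrink slightly to restore the graph norm bound. Continuity of
the finitely many eigenpairs in F makes the last two costs small.

One F must serve every small t, although infinitely many eigenvalues move, with no uniformity. This
is `exists_spectral_window`: take Λ different from all |λₙ(0)|. An eigenvalue of index outside F
entering [-Λ, Λ] would first meet ±Λ. At that moment the spectrum in the window would hold that
point besides the continuations of all its original points, which are still distinct and strictly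
inside, against the constancy of the count. -/

section UnboundedOperators

/-! ### Graph norms and their unit balls -/

variable {H : Type*} [NormedAddCommGroup H] [InnerProductSpace ℂ H] {D : H →ₗ.[ℂ] H}

theorem graphNorm_coe (ξ : D.domain) : graphNorm D ξ = ‖(ξ : H)‖ₑ + ‖D ξ‖ₑ :=
  iInf_pos ξ.2

theorem graphNorm_of_notMem {ξ : H} (h : ξ ∉ D.domain) : graphNorm D ξ = ∞ := by
  simp [graphNorm, h]

theorem mem_domain_of_graphNorm_lt {ξ : H} (h : graphNorm D ξ < ∞) : ξ ∈ D.domain := by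
  by_contra h'
  simp [graphNorm_of_notMem h'] at h

theorem graphNorm_coe_eq_ofReal (ξ : D.domain) :
    graphNorm D ξ = ENNReal.ofReal (‖(ξ : H)‖ + ‖D ξ‖) := by
  rw [graphNorm_coe, ENNReal.ofReal_add (norm_nonneg _) (norm_nonneg _), ofReal_norm, ofReal_norm]

theorem graphNorm_le_iff {ξ : H} {r : ℝ} (hr : 0 ≤ r) : graphNorm D ξ ≤ ENNReal.ofReal r ↔
    ∃ h : ξ ∈ D.domain, ‖ξ‖ + ‖D ⟨ξ, h⟩‖ ≤ r := by
  constructor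
  · intro h
    have hm := mem_domain_of_graphNorm_lt (h.trans_lt ENNReal.ofReal_lt_top)
    refine ⟨hm, ?_⟩
    have := graphNorm_coe_eq_ofReal (D := D) ⟨ξ, hm⟩
    rw [this] at h
    exact (ENNReal.ofReal_le_ofReal_iff hr).1 h
  · rintro ⟨hm, h⟩
    have := graphNorm_coe_eq_ofReal (D := D) ⟨ξ, hm⟩
    rw [this]
    exact ENNReal.ofReal_le_ofReal h

theorem enorm_le_graphNorm (ξ : H) : ‖ξ‖ₑ ≤ graphNorm D ξ :=
  le_iInf fun _ => le_self_add

theorem graphNorm_add_le (x y : H) : graphNorm D (x + y) ≤ graphNorm D x + graphNorm D y := by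
  by_cases hx : x ∈ D.domain
  · by_cases hy : y ∈ D.domain
    · have h1 := graphNorm_coe (D := D) ⟨x, hx⟩
      have h2 := graphNorm_coe (D := D) ⟨y, hy⟩
      have h3 := graphNorm_coe (D := D) (⟨x, hx⟩ + ⟨y, hy⟩)
      rw [D.map_add] at h3
      simp only [Submodule.coe_add] at h1 h2 h3
      rw [h1, h2, h3]
      calc _ ≤ (‖x‖ₑ + ‖y‖ₑ) + (‖D ⟨x, hx⟩‖ₑ + ‖D ⟨y, hy⟩‖ₑ) :=
            add_le_add (enorm_add_le _ _) (enorm_add_le _ _)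
        _ = _ := by ring
    · simp [graphNorm_of_notMem hy]
  · simp [graphNorm_of_notMem hx]

theorem graphNorm_zero : graphNorm D 0 = 0 := by
  have := graphNorm_coe (D := D) 0
  simpa using this

theorem graphNorm_smul (c : ℂ) (x : H) : graphNorm D (c • x) = ‖c‖ₑ * graphNorm D x := by
  rcases eq_or_ne c 0 with rfl | hc
  · simp [graphNorm_zero]
  by_cases hx : x ∈ D.domain
  · have h1 := graphNorm_coe (D := D) ⟨x, hx⟩
    have h3 := graphNorm_coe (D := D) (c • ⟨x, hx⟩)
    rw [D.map_smul] at h3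
    simp only [Submodule.coe_smul] at h1 h3
    rw [h1, h3, enorm_smul, enorm_smul, mul_add]
  · have : c • x ∉ D.domain := fun h => hx ((D.domain.smul_mem_iff hc).1 h)
    rw [graphNorm_of_notMem hx, graphNorm_of_notMem this, ENNReal.mul_top (by simpa using hc)]

variable [CompleteSpace H]

theorem IsSelfAdjoint.inner_apply_left (hD : IsSelfAdjoint D) (x y : D.domain) :
    inner ℂ (D x) (y : H) = inner ℂ (x : H) (D y) := by
  have h := LinearPMap.adjoint_isFormalAdjoint hD.dense_domain
  rw [LinearPMap.isSelfAdjoint_def.mp hD] at h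
  exact h x y

/-- The bound says that ξ lies in the domain of the adjoint, which is D. By density it extends to
all test vectors, and testing against Dξ itself bounds the norm. -/
theorem IsSelfAdjoint.exists_mem_domain (hD : IsSelfAdjoint D) {ξ : H} {C : ℝ} (hC0 : 0 ≤ C)
    (hC : ∀ η : D.domain, ‖inner ℂ ξ (D η)‖ ≤ C * ‖(η : H)‖) :
    ∃ h : ξ ∈ D.domain, ‖D ⟨ξ, h⟩‖ ≤ C := by
  have hm : ξ ∈ D.adjoint.domain := by
    rw [LinearPMap.mem_adjoint_domain_iff]
    exact AddMonoidHomClass.continuous_of_bound _ C hC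
  rw [LinearPMap.isSelfAdjoint_def.mp hD] at hm
  refine ⟨hm, ?_⟩
  have key : ∀ x : H, ‖inner ℂ (D ⟨ξ, hm⟩) x‖ ≤ C * ‖x‖ := by
    intro x
    refine hD.dense_domain.induction (P := fun x => ‖inner ℂ (D ⟨ξ, hm⟩) x‖ ≤ C * ‖x‖) ?_ ?_ x
    · intro y hy
      have := hC ⟨y, hy⟩
      rwa [← hD.inner_apply_left ⟨ξ, hm⟩ ⟨y, hy⟩] at this
    · exact isClosed_le (by fun_prop) (by fun_prop)
  have := key (D ⟨ξ, hm⟩)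
  rw [inner_self_eq_norm_sq_to_K, norm_pow, RCLike.norm_ofReal, abs_norm, sq] at this
  rcases (norm_nonneg (D ⟨ξ, hm⟩)).eq_or_lt with h0 | h0
  · rwa [← h0]
  · exact le_of_mul_le_mul_right this h0

/-- By duality, ‖Dξ‖ ≤ 1 - ‖ξ‖ becomes a family of inequalities continuous in ξ, one for each η in
the domain. -/
theorem isClosed_graphNorm_le (hD : IsSelfAdjoint D) : IsClosed {ξ | graphNorm D ξ ≤ 1} := by
  have : {ξ | graphNorm D ξ ≤ 1} = {ξ : H | ‖ξ‖ ≤ 1} ∩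
      ⋂ η : D.domain, {ξ : H | ‖inner ℂ ξ (D η)‖ ≤ (1 - ‖ξ‖) * ‖(η : H)‖} := by
    ext ξ
    have h1 := graphNorm_le_iff (D := D) (ξ := ξ) zero_le_one
    rw [ENNReal.ofReal_one] at h1
    simp only [Set.mem_ofPred_eq, Set.mem_inter_iff, Set.mem_iInter, h1]
    constructor
    · rintro ⟨hm, h⟩
      refine ⟨by linarith [norm_nonneg (D ⟨ξ, hm⟩)], fun η => ?_⟩
      rw [← hD.inner_apply_left ⟨ξ, hm⟩ η]
      refine (norm_inner_le_norm _ _).trans ?_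
      gcongr
      linarith
    · rintro ⟨h1, h2⟩
      obtain ⟨hm, h⟩ := hD.exists_mem_domain (by linarith) h2
      exact ⟨hm, by linarith⟩
  rw [this]
  refine IsClosed.inter (isClosed_le (by fun_prop) (by fun_prop)) (isClosed_iInter fun η => ?_)
  exact isClosed_le (by fun_prop) (by fun_prop)

/-- On the ball, ξ = R((D - z)ξ) with ‖(D - z)ξ‖ ≤ 1 + ‖z‖, so the ball is a closed part of a
relatively compact image. -/
theorem isCompact_graphNorm_le (hD : IsSelfAdjoint D) {z : ℂ} {R : H →L[ℂ] H}
    (hR : IsResolventAt D z R) (hRc : IsCompactOperator R) :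
    IsCompact {ξ | graphNorm D ξ ≤ 1} := by
  obtain ⟨K, hK, hKs⟩ := hRc.image_closedBall_subset_compact (𝕜₁ := ℂ) (1 + ‖z‖)
  refine hK.of_isClosed_subset (isClosed_graphNorm_le hD) fun ξ hξ => hKs ?_
  have h1 := graphNorm_le_iff (D := D) (ξ := ξ) zero_le_one
  rw [ENNReal.ofReal_one] at h1
  obtain ⟨hm, h⟩ := h1.1 hξ
  refine ⟨D ⟨ξ, hm⟩ - z • ξ, ?_, hR.2 ⟨ξ, hm⟩⟩
  rw [mem_closedBall_zero_iff]
  refine (norm_sub_le _ _).trans ?_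
  rw [norm_smul]
  have : ‖z‖ * ‖ξ‖ ≤ ‖z‖ * 1 := by
    gcongr
    linarith [norm_nonneg (D ⟨ξ, hm⟩)]
  linarith [norm_nonneg ξ]

/-! ### Eigenbases -/

/-- The Hilbert basis `b` consists of eigenvectors of `D` with eigenvalues `lam`. -/
def IsEigenbasis (D : H →ₗ.[ℂ] H) (b : HilbertBasis ℕ ℂ H) (lam : ℕ → ℝ) : Prop :=
  ∀ n, ∃ h : b n ∈ D.domain, D ⟨b n, h⟩ = (lam n : ℂ) • b n

variable {b : HilbertBasis ℕ ℂ H} {lam : ℕ → ℝ}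

omit [CompleteSpace H] in
theorem IsEigenbasis.mem_domain (hb : IsEigenbasis D b lam) (n : ℕ) : b n ∈ D.domain :=
  (hb n).1

omit [CompleteSpace H] in
theorem IsEigenbasis.apply (hb : IsEigenbasis D b lam) (n : ℕ) :
    D ⟨b n, hb.mem_domain n⟩ = (lam n : ℂ) • b n :=
  (hb n).2

theorem IsEigenbasis.inner_apply (hb : IsEigenbasis D b lam) (hD : IsSelfAdjoint D)
    (ξ : D.domain) (n : ℕ) : inner ℂ (b n) (D ξ) = lam n * inner ℂ (b n) (ξ : H) := by
  rw [← hD.inner_apply_left ⟨b n, hb.mem_domain n⟩ ξ, hb.apply, inner_smul_left, Complex.conj_ofReal]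

omit [CompleteSpace H] in
theorem IsEigenbasis.resolvent_apply (hb : IsEigenbasis D b lam) {z : ℂ} {R : H →L[ℂ] H}
    (hR : IsResolventAt D z R) (n : ℕ) : (lam n - z) • R (b n) = b n := by
  have := hR.2 ⟨b n, hb.mem_domain n⟩
  rwa [hb.apply, ← sub_smul, map_smul] at this

omit [CompleteSpace H] in
theorem IsEigenbasis.eigenvalue_sub_ne_zero (hb : IsEigenbasis D b lam) {z : ℂ} {R : H →L[ℂ] H}
    (hR : IsResolventAt D z R) (n : ℕ) : (lam n - z) ≠ 0 := by
  intro h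
  have h1 := hb.resolvent_apply hR n
  rw [h, zero_smul] at h1
  exact b.orthonormal.ne_zero n h1.symm

omit [CompleteSpace H] in
theorem IsEigenbasis.mem_spectrum (hb : IsEigenbasis D b lam) (n : ℕ) :
    (lam n : ℂ) ∈ unboundedSpectrum D := by
  rintro ⟨R, hR⟩
  exact hb.eigenvalue_sub_ne_zero hR n (sub_self _)

omit [CompleteSpace H] in
-- Otherwise R would send infinitely many basis vectors to orthogonal vectors with norms bounded
-- below. A limit x of a subsequence would satisfy ⟨x, x⟩ = 0, as a limit of inner products of
-- consecutive terms, yet be nonzero.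
theorem IsEigenbasis.finite_abs_le (hb : IsEigenbasis D b lam) {z : ℂ} {R : H →L[ℂ] H}
    (hR : IsResolventAt D z R) (hRc : IsCompactOperator R) (Λ : ℝ) :
    {n | |lam n| ≤ Λ}.Finite := by
  by_contra hinf
  obtain ⟨K, hK, hKs⟩ := hRc.image_closedBall_subset_compact (𝕜₁ := ℂ) 1
  have hinf : {n | |lam n| ≤ Λ}.Infinite := hinf
  let u : ℕ → ℕ := fun k => hinf.natEmbedding _ k
  have hu : ∀ k, |lam (u k)| ≤ Λ := fun k => (hinf.natEmbedding _ k).2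
  have hui : Function.Injective u :=
    Subtype.val_injective.comp (hinf.natEmbedding _).injective
  obtain ⟨x, -, φ, hφ, hx⟩ := hK.tendsto_subseq (x := fun k => R (b (u k))) fun k =>
    hKs ⟨b (u k), by simp [b.orthonormal.1], rfl⟩
  have hle : ∀ k, 1 ≤ (Λ + ‖z‖) * ‖R (b (u k))‖ := by
    intro k
    have h1 := congrArg norm (hb.resolvent_apply hR (u k))
    rw [norm_smul, b.orthonormal.1] at h1
    rw [← h1]
    gcongr
    refine (norm_sub_le _ _).trans ?_
    have := hu k
    simpa using this
  have horth : ∀ k l, k ≠ l → inner ℂ (R (b (u k))) (R (b (u l))) = 0 := by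
    intro k l hkl
    have h1 : inner ℂ (b (u k)) (b (u l)) = 0 := b.orthonormal.2 (hui.ne hkl)
    rw [← hb.resolvent_apply hR (u k), ← hb.resolvent_apply hR (u l), inner_smul_left,
      inner_smul_right] at h1
    have h2 := hb.eigenvalue_sub_ne_zero hR (u k)
    have h3 := hb.eigenvalue_sub_ne_zero hR (u l)
    have h4 := (mul_eq_zero.1 h1).resolve_left ((map_ne_zero _).2 h2)
    exact (mul_eq_zero.1 h4).resolve_left h3
  have hlim : Tendsto (fun k => inner ℂ (R (b (u (φ k)))) (R (b (u (φ (k + 1)))))) atTop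
      (𝓝 (inner ℂ x x)) :=
    hx.inner (hx.comp (tendsto_add_atTop_nat 1))
  have h0 : inner ℂ x x = 0 := by
    refine tendsto_nhds_unique hlim ?_
    refine tendsto_const_nhds.congr fun k => (horth _ _ ?_).symm
    exact hφ.injective.ne (Nat.succ_ne_self k).symm
  rw [inner_self_eq_zero] at h0
  have h2 : 1 ≤ (Λ + ‖z‖) * ‖x‖ :=
    ge_of_tendsto' (tendsto_const_nhds.mul hx.norm) fun k => hle (φ k)
  rw [h0, norm_zero, mul_zero] at h2
  exact absurd h2 (by norm_num)

/-- Fredholm alternative for R at μ = (z - z₀)⁻¹. If z is no eigenvalue λₙ, an eigenvector of R for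
μ would have only zero coefficients, so μ - R is invertible, and D - z with it. -/
theorem IsEigenbasis.exists_eq_of_mem_spectrum (hb : IsEigenbasis D b lam) (hD : IsSelfAdjoint D)
    {z₀ : ℂ} {R : H →L[ℂ] H} (hR : IsResolventAt D z₀ R) (hRc : IsCompactOperator R) {z : ℂ}
    (hz : z ∈ unboundedSpectrum D) : ∃ n, (lam n : ℂ) = z := by
  by_contra! hne
  apply hz
  rcases eq_or_ne z z₀ with rfl | hz₀
  · exact ⟨R, hR⟩
  have hμ : (z - z₀)⁻¹ ≠ 0 := inv_ne_zero (sub_ne_zero.2 hz₀)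
  have hzz := sub_ne_zero.2 hz₀
  rcases hRc.hasEigenvalue_or_mem_resolventSet hμ with h | h
  · exfalso
    obtain ⟨x, hx⟩ := h.exists_hasEigenvector
    have hx1 : R x = (z - z₀)⁻¹ • x := hx.apply_eq_smul
    obtain ⟨hm, hm'⟩ := hR.1 x
    apply hx.2
    refine b.repr.injective ?_
    ext n
    rw [map_zero, b.repr_apply_apply]
    have h1 := hb.inner_apply hD ⟨R x, hm⟩ n
    rw [sub_eq_iff_eq_add.1 hm', inner_add_right, inner_smul_right] at h1
    dsimp only at h1
    rw [hx1, inner_smul_right] at h1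
    have h2 : ((lam n : ℂ) - z) * inner ℂ (b n) x = 0 := by
      field_simp at h1
      linear_combination -h1
    have := (mul_eq_zero.1 h2).resolve_left (sub_ne_zero.2 (hne n))
    simpa using this
  · obtain ⟨S, hS⟩ : IsUnit (algebraMap ℂ (H →L[ℂ] H) (z - z₀)⁻¹ - R) := h
    have hS1 : ∀ x, (z - z₀)⁻¹ • (S⁻¹.val x) - R (S⁻¹.val x) = x := by
      intro x
      have h1 : S.val * S⁻¹.val = 1 := S.mul_inv
      rw [hS] at h1
      simpa [Algebra.algebraMap_eq_smul_one] using congrArg (fun T : H →L[ℂ] H => T x) h1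
    have hS2 : ∀ x, S⁻¹.val ((z - z₀)⁻¹ • x - R x) = x := by
      intro x
      have h1 : S⁻¹.val * S.val = 1 := S.inv_mul
      rw [hS] at h1
      simpa [Algebra.algebraMap_eq_smul_one] using congrArg (fun T : H →L[ℂ] H => T x) h1
    -- The inverse is read off from D - z = (z - z₀)(μ - R)(D - z₀), where S = μ - R.
    refine ⟨(z - z₀)⁻¹ • (R * S⁻¹.val), fun x => ?_, fun x => ?_⟩
    · obtain ⟨hm, hm'⟩ := hR.1 ((z - z₀)⁻¹ • S⁻¹.val x)
      have he : ((z - z₀)⁻¹ • (R * S⁻¹.val)) x = R ((z - z₀)⁻¹ • S⁻¹.val x) := by simp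
      rw [he]
      refine ⟨hm, ?_⟩
      rw [sub_eq_iff_eq_add.1 hm']
      have h2 : (z - z₀) • R ((z - z₀)⁻¹ • S⁻¹.val x) = R (S⁻¹.val x) := by
        rw [map_smul, smul_inv_smul₀ hzz]
      have h3 := hS1 x
      rw [← h2] at h3
      nth_rw 4 [← h3]
      module
    · have h1 := hR.2 x
      have h2 : D x - z • (x : H) =
          (z - z₀) • ((z - z₀)⁻¹ • (D x - z₀ • (x : H)) - R (D x - z₀ • (x : H))) := by
        rw [smul_sub, smul_inv_smul₀ hzz, h1]
        module
      rw [h2, map_smul]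
      simp only [smul_apply, mul_apply_eq_comp]
      rw [hS2, h1, smul_inv_smul₀ hzz]

end UnboundedOperators

/-! ### The unitary group of a diagonal operator -/

section UnitaryGroup

variable {H : Type*} [NormedAddCommGroup H] [InnerProductSpace ℂ H]

theorem HilbertBasis.ext_inner {ι : Type*} (b : HilbertBasis ι ℂ H) {x y : H}
    (h : ∀ n, inner ℂ (b n) x = inner ℂ (b n) y) : x = y := by
  refine b.repr.injective ?_
  ext n
  simpa only [b.repr_apply_apply] using h n

theorem HilbertBasis.hasSum_norm_sq {ι : Type*} (b : HilbertBasis ι ℂ H) (x : H) :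
    HasSum (fun n => ‖inner ℂ (b n) x‖ ^ 2) (‖x‖ ^ 2) := by
  have h := b.hasSum_inner_mul_inner x x
  rw [inner_self_eq_norm_sq_to_K] at h
  have h1 : (fun n => inner ℂ x (b n) * inner ℂ (b n) x) =
      fun n => ((‖inner ℂ (b n) x‖ ^ 2 : ℝ) : ℂ) := by
    funext n
    rw [← inner_conj_symm x (b n), Complex.conj_mul', Complex.ofReal_pow]
  rw [h1] at h
  exact Complex.hasSum_ofReal.1 (by rw [Complex.ofReal_pow]; exact h)

/-- Parseval; it turns norm estimates for diagonal operators into scalar ones. -/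
theorem HilbertBasis.norm_le_norm {ι : Type*} (b : HilbertBasis ι ℂ H) {x y : H}
    (h : ∀ n, ‖inner ℂ (b n) x‖ ≤ ‖inner ℂ (b n) y‖) : ‖x‖ ≤ ‖y‖ := by
  refine le_of_sq_le_sq ?_ (norm_nonneg _)
  exact hasSum_le (fun n => by gcongr; exact h n) (b.hasSum_norm_sq x) (b.hasSum_norm_sq y)

variable [CompleteSpace H] (b : HilbertBasis ℕ ℂ H) (lam : ℕ → ℝ)

/-- The Hilbert basis `exp (i s λₙ) bₙ`. -/
noncomputable def rotatedBasis (s : ℝ) : HilbertBasis ℕ ℂ H :=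
  HilbertBasis.mkOfOrthogonalEqBot (v := fun n => Complex.exp (Complex.I * (s * lam n : ℝ)) • b n)
    (by
      have hn : ∀ n, ‖Complex.exp (Complex.I * (s * lam n : ℝ))‖ = 1 := fun n => by
        rw [mul_comm, Complex.norm_exp_ofReal_mul_I]
      refine ⟨fun n => by rw [norm_smul, hn, b.orthonormal.1, one_mul], fun n m hnm => ?_⟩
      have : inner ℂ (b n) (b m) = 0 := b.orthonormal.2 hnm
      simp [inner_smul_left, inner_smul_right, this])
    (by
      rw [Submodule.eq_bot_iff]
      intro x hx
      refine b.ext_inner fun n => ?_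
      have := (Submodule.mem_orthogonal _ _).1 hx _ (Submodule.subset_span ⟨n, rfl⟩)
      rw [inner_smul_left] at this
      rw [inner_zero_right]
      exact (mul_eq_zero.1 this).resolve_left ((map_ne_zero _).2 (Complex.exp_ne_zero _)))

theorem rotatedBasis_apply (s : ℝ) (n : ℕ) :
    rotatedBasis b lam s n = Complex.exp (Complex.I * (s * lam n : ℝ)) • b n := by
  simp [rotatedBasis]

/-- The unitary group `bₙ ↦ exp (i s λₙ) bₙ`. -/
noncomputable def diagonalGroup (s : ℝ) : H →L[ℂ] H :=
  (Unitary.linearIsometryEquiv.symm (b.repr.trans (rotatedBasis b lam s).repr.symm)).1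

theorem inner_diagonalGroup (s : ℝ) (n : ℕ) (x : H) : inner ℂ (b n) (diagonalGroup b lam s x) =
    Complex.exp (Complex.I * (s * lam n : ℝ)) * inner ℂ (b n) x := by
  have h1 : (rotatedBasis b lam s).repr (diagonalGroup b lam s x) = b.repr x := by
    simp [diagonalGroup]
  have h2 := congrArg (fun f => f n) h1
  simp only [HilbertBasis.repr_apply_apply, rotatedBasis_apply] at h2
  rw [← h2, inner_smul_left, ← mul_assoc, ← Complex.exp_conj, ← Complex.exp_add]
  simp

variable {b lam} {D : H →ₗ.[ℂ] H}

theorem IsEigenbasis.norm_diagonalGroup_sub_le (hb : IsEigenbasis D b lam) (hD : IsSelfAdjoint D)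
    (s : ℝ) (ξ : D.domain) : ‖diagonalGroup b lam s ξ - ξ‖ ≤ |s| * ‖D ξ‖ := by
  have : |s| * ‖D ξ‖ = ‖(s : ℂ) • D ξ‖ := by simp [norm_smul]
  rw [this]
  refine b.norm_le_norm fun n => ?_
  rw [inner_sub_right, inner_diagonalGroup, inner_smul_right, hb.inner_apply hD, ← sub_one_mul,
    norm_mul, ← mul_assoc, norm_mul]
  gcongr
  refine (Real.norm_exp_I_mul_ofReal_sub_one_le).trans ?_
  simp

/-- Orbits of domain vectors are Lipschitz; since the group is isometric, continuity passes to all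
orbits by uniform approximation. For the derivative, the orbit of ξ is identified with ξ + ∫
U_r(iDξ) dr, coefficient by coefficient, so no series is differentiated. -/
theorem IsEigenbasis.isUnitaryGroupOf (hb : IsEigenbasis D b lam) (hD : IsSelfAdjoint D) :
    IsUnitaryGroupOf D (diagonalGroup b lam) := by
  have hadd : ∀ r s, diagonalGroup b lam (r + s) = diagonalGroup b lam r * diagonalGroup b lam s := by
    intro r s
    ext x
    refine b.ext_inner fun n => ?_
    rw [mul_apply_eq_comp, inner_diagonalGroup, inner_diagonalGroup, inner_diagonalGroup,
      ← mul_assoc, ← Complex.exp_add]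
    congr 2
    push_cast
    ring
  have hzero : diagonalGroup b lam 0 = 1 := by
    ext x
    refine b.ext_inner fun n => ?_
    rw [inner_diagonalGroup]
    simp
  have hnorm : ∀ s x, ‖diagonalGroup b lam s x‖ = ‖x‖ := by
    intro s x
    simp [diagonalGroup]
  have hdom : ∀ ξ : D.domain, Continuous fun s => diagonalGroup b lam s (ξ : H) := by
    intro ξ
    refine (LipschitzWith.of_dist_le_mul (K := ‖D ξ‖₊) fun s r => ?_).continuous
    have h1 : diagonalGroup b lam s = diagonalGroup b lam r * diagonalGroup b lam (s - r) := by
      rw [← hadd, add_sub_cancel]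
    rw [dist_eq_norm, h1, mul_apply_eq_comp, ← map_sub, hnorm, Real.dist_eq, mul_comm]
    exact hb.norm_diagonalGroup_sub_le hD _ ξ
  have hcont : ∀ ξ : H, Continuous fun s => diagonalGroup b lam s ξ := by
    intro ξ
    refine continuous_of_uniform_approx_of_continuous fun u hu => ?_
    obtain ⟨ε, hε, hεu⟩ := Metric.mem_uniformity_dist.1 hu
    obtain ⟨η, hη, hηξ⟩ := Metric.mem_closure_iff.1 (hD.dense_domain ξ) ε hε
    refine ⟨_, hdom ⟨η, hη⟩, fun s => hεu ?_⟩
    rwa [dist_eq_norm, ← map_sub, hnorm, ← dist_eq_norm]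
  refine ⟨fun s => (Unitary.linearIsometryEquiv.symm _).2, hzero, hadd, hcont, fun ξ => ?_⟩
  have hint : Continuous fun s => diagonalGroup b lam s (Complex.I • D ξ) := hcont _
  have hF : ∀ s, HasDerivAt
      (fun s : ℝ => (ξ : H) + ∫ r in (0 : ℝ)..s, diagonalGroup b lam r (Complex.I • D ξ))
      (diagonalGroup b lam s (Complex.I • D ξ)) s := fun s =>
    (intervalIntegral.integral_hasDerivAt_right (hint.intervalIntegrable _ _)
      (hint.stronglyMeasurableAtFilter _ _) hint.continuousAt).const_add _
  have heq : (fun s : ℝ => diagonalGroup b lam s (ξ : H)) =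
      fun s : ℝ => (ξ : H) + ∫ r in (0 : ℝ)..s, diagonalGroup b lam r (Complex.I • D ξ) := by
    funext s
    refine b.ext_inner fun n => ?_
    have hd : ∀ r : ℝ, HasDerivAt (fun s : ℝ => inner ℂ (b n) (diagonalGroup b lam s (ξ : H)) -
        inner ℂ (b n) ((ξ : H) + ∫ r in (0 : ℝ)..s, diagonalGroup b lam r (Complex.I • D ξ)))
        0 r := by
      intro r
      have h1 := (hasDerivAt_const r (b n)).inner ℂ (hF r)
      have h2 : HasDerivAt (fun s : ℝ => Complex.exp (Complex.I * (s * lam n : ℝ)))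
          (Complex.exp (Complex.I * (r * lam n : ℝ)) * (Complex.I * (lam n : ℝ))) r := by
        have h3 : HasDerivAt (fun s : ℝ => Complex.I * (s * lam n : ℝ))
            (Complex.I * (lam n : ℝ)) r := by
          have := ((hasDerivAt_id r).mul_const (lam n)).ofReal_comp.const_mul Complex.I
          simpa using this
        exact h3.cexp
      have h4 := h2.mul_const (inner ℂ (b n) (ξ : H))
      simp_rw [inner_diagonalGroup] at h1 ⊢
      refine (h4.sub h1).congr_deriv ?_
      rw [inner_zero_left, add_zero, inner_smul_right, hb.inner_apply hD]
      ring
    have := is_const_of_deriv_eq_zero (fun r => (hd r).differentiableAt)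
      (fun r => (hd r).deriv) s 0
    rw [hzero] at this
    simpa [sub_eq_zero] using this
  rw [heq]
  simpa [hzero] using hF 0

/-- Existence excludes the default value in `expI`; uniqueness then identifies `expI D` with
`diagonalGroup`. -/
theorem IsEigenbasis.isUnitaryGroupOf_expI (hb : IsEigenbasis D b lam) (hD : IsSelfAdjoint D) :
    IsUnitaryGroupOf D (expI D) := by
  have h : ∃ U, IsUnitaryGroupOf D U := ⟨_, hb.isUnitaryGroupOf hD⟩
  rw [expI, dif_pos h]
  exact h.choose_spec

theorem IsEigenbasis.norm_expI_apply (hb : IsEigenbasis D b lam) (hD : IsSelfAdjoint D) (s : ℝ)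
    (x : H) : ‖expI D s x‖ = ‖x‖ := by
  rw [(hb.isUnitaryGroupOf_expI hD).unique hD (hb.isUnitaryGroupOf hD)]
  simp [diagonalGroup]

theorem IsEigenbasis.expI_apply_basis (hb : IsEigenbasis D b lam) (hD : IsSelfAdjoint D) (s : ℝ)
    (n : ℕ) : expI D s (b n) = Complex.exp (Complex.I * (s * lam n : ℝ)) • b n := by
  rw [(hb.isUnitaryGroupOf_expI hD).unique hD (hb.isUnitaryGroupOf hD), ← rotatedBasis_apply]
  refine (rotatedBasis b lam s).repr.injective ?_
  simp [diagonalGroup, HilbertBasis.repr_self]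

end UnitaryGroup

/-! ### Transplanting vectors between eigenbases -/

section Approximation

variable {H : Type*} [NormedAddCommGroup H] [InnerProductSpace ℂ H]

/-- Bessel's inequality: moving coefficients to another orthonormal family costs no norm, whatever
the size of F. -/
theorem Orthonormal.norm_sum_inner_smul_le {ι : Type*} {v w : ι → H} (hv : Orthonormal ℂ v)
    (hw : Orthonormal ℂ w) (F : Finset ι) (x : H) : ‖∑ n ∈ F, inner ℂ (v n) x • w n‖ ≤ ‖x‖ := by
  refine le_of_sq_le_sq ?_ (norm_nonneg _)
  refine le_trans (le_of_eq ?_) (hv.sum_inner_products_le x (s := F))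
  have h := hw.inner_sum (fun n => inner ℂ (v n) x) (fun n => inner ℂ (v n) x) F
  rw [inner_self_eq_norm_sq_to_K] at h
  simp_rw [Complex.conj_mul'] at h
  refine Complex.ofReal_injective ?_
  push_cast
  exact h

variable [CompleteSpace H] {D D' : H →ₗ.[ℂ] H} {b b' : HilbertBasis ℕ ℂ H} {lam lam' : ℕ → ℝ}

/-- Off F, the coefficient of Dξ is λₙ times that of ξ, hence at least Λ times as large in modulus.
-/
theorem IsEigenbasis.norm_sub_sum_le (hb : IsEigenbasis D b lam) (hD : IsSelfAdjoint D)
    {F : Finset ℕ} {Λ : ℝ} (hΛ : 0 < Λ) (hF : ∀ n ∉ F, Λ ≤ |lam n|) (ξ : D.domain) :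
    ‖(ξ : H) - ∑ n ∈ F, inner ℂ (b n) (ξ : H) • b n‖ ≤ Λ⁻¹ * ‖D ξ‖ := by
  have h1 : Λ⁻¹ * ‖D ξ‖ = ‖((Λ⁻¹ : ℝ) : ℂ) • D ξ‖ := by
    rw [norm_smul, Complex.norm_real, Real.norm_of_nonneg (inv_nonneg.2 hΛ.le)]
  rw [h1]
  refine b.norm_le_norm fun n => ?_
  by_cases hn : n ∈ F
  · rw [inner_sub_right, b.orthonormal.inner_right_sum _ hn, sub_self, norm_zero]
    exact norm_nonneg _
  · have h2 : inner ℂ (b n) (∑ m ∈ F, inner ℂ (b m) (ξ : H) • b m) = 0 := by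
      rw [inner_sum]
      refine Finset.sum_eq_zero fun m hm => ?_
      have : inner ℂ (b n) (b m) = 0 := b.orthonormal.2 fun h => hn (h ▸ hm)
      rw [inner_smul_right, this, mul_zero]
    rw [inner_sub_right, h2, sub_zero, inner_smul_right, hb.inner_apply hD, ← mul_assoc, norm_mul,
      norm_mul, Complex.norm_real, Complex.norm_real, Real.norm_of_nonneg (inv_nonneg.2 hΛ.le)]
    refine le_mul_of_one_le_left (norm_nonneg _) ?_
    rw [inv_mul_eq_div, one_le_div hΛ]
    exact hF n hn

theorem norm_exp_I_mul_sub_exp_I_mul_le (x y : ℝ) :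
    ‖Complex.exp (Complex.I * x) - Complex.exp (Complex.I * y)‖ ≤ |x - y| := by
  have : Complex.exp (Complex.I * x) - Complex.exp (Complex.I * y) =
      Complex.exp (Complex.I * y) * (Complex.exp (Complex.I * (x - y : ℝ)) - 1) := by
    rw [mul_sub, ← Complex.exp_add, mul_one]
    congr 2
    push_cast
    ring
  rw [this, norm_mul, Complex.norm_exp_I_mul_ofReal, one_mul]
  exact Real.norm_exp_I_mul_ofReal_sub_one_le

/-- Vectors in the domain of `D` are approximated, together with their orbits, by vectors in the
domain of `D'` of no larger graph norm. -/
theorem IsEigenbasis.exists_approx (hb : IsEigenbasis D b lam) (hD : IsSelfAdjoint D)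
    (hb' : IsEigenbasis D' b' lam') (hD' : IsSelfAdjoint D') {F : Finset ℕ} {Λ κ S : ℝ}
    (hΛ : 0 < Λ) (hF : ∀ n ∉ F, Λ ≤ |lam n|) (h1 : ∑ n ∈ F, |lam n - lam' n| ≤ κ)
    (h2 : ∑ n ∈ F, ‖b n - b' n‖ ≤ κ) (ξ : D.domain) :
    ∃ η : D'.domain, ‖(η : H)‖ + ‖D' η‖ ≤ ‖(ξ : H)‖ + ‖D ξ‖ ∧ ∀ s, 0 ≤ s → s ≤ S →
      ‖expI D s ξ - expI D' s η‖ ≤ (Λ⁻¹ + S * κ + 2 * κ) * (‖(ξ : H)‖ + ‖D ξ‖) := by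
  have hκ : 0 ≤ κ := le_trans (Finset.sum_nonneg fun n _ => abs_nonneg _) h1
  set c : ℕ → ℂ := fun n => inner ℂ (b n) (ξ : H) with hc
  have hcn : ∀ n, ‖c n‖ ≤ ‖(ξ : H)‖ := fun n => by
    have := norm_inner_le_norm (𝕜 := ℂ) (b n) (ξ : H)
    rwa [b.orthonormal.1, one_mul] at this
  let ζ : D'.domain := ∑ n ∈ F, c n • ⟨b' n, hb'.mem_domain n⟩
  have hζ : (ζ : H) = ∑ n ∈ F, c n • b' n := by simp [ζ]
  have hζn : ‖(ζ : H)‖ ≤ ‖(ξ : H)‖ := by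
    rw [hζ]
    exact b.orthonormal.norm_sum_inner_smul_le b'.orthonormal F _
  -- Splitting λ'ₙ = λₙ + (λ'ₙ - λₙ): the first sum is a transplanted truncation of Dξ, the second
  -- is of size κ‖ξ‖.
  have hDζ : D' ζ = ∑ n ∈ F, inner ℂ (b n) (D ξ) • b' n +
      ∑ n ∈ F, ((lam' n - lam n : ℝ) * c n : ℂ) • b' n := by
    rw [← Finset.sum_add_distrib]
    change D'.toFun ζ = _
    rw [map_sum]
    refine Finset.sum_congr rfl fun n _ => ?_
    rw [map_smul]
    change c n • D' _ = _
    rw [hb'.apply, hb.inner_apply hD, smul_smul, ← add_smul]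
    congr 1
    push_cast
    ring
  have hDζn : ‖D' ζ‖ ≤ ‖D ξ‖ + κ * ‖(ξ : H)‖ := by
    rw [hDζ]
    refine norm_add_le_of_le (b.orthonormal.norm_sum_inner_smul_le b'.orthonormal F _) ?_
    refine (norm_sum_le _ _).trans (le_trans ?_ (mul_le_mul_of_nonneg_right h1 (norm_nonneg _)))
    rw [Finset.sum_mul]
    refine Finset.sum_le_sum fun n _ => ?_
    rw [norm_smul, b'.orthonormal.1, mul_one, norm_mul, Complex.norm_real, Real.norm_eq_abs,
      abs_sub_comm]
    gcongr
    exact hcn n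
  have hκ1 : (0 : ℝ) < 1 + κ := by linarith
  -- The graph norm of ζ exceeds that of ξ by a factor of at most 1 + κ. Scaling by θ removes this
  -- factor and moves ζ by at most κ‖ξ‖.
  set θ : ℝ := (1 + κ)⁻¹ with hθ
  have hθ0 : 0 ≤ θ := inv_nonneg.2 hκ1.le
  have hθκ : θ * (1 + κ) = 1 := inv_mul_cancel₀ hκ1.ne'
  have hθ1 : θ ≤ 1 := by nlinarith
  have hθ2 : 1 - θ ≤ κ := by nlinarith
  have hθn : ‖(θ : ℂ)‖ = θ := by rw [Complex.norm_real, Real.norm_of_nonneg hθ0]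
  refine ⟨(θ : ℂ) • ζ, ?_, fun s hs0 hs => ?_⟩
  · rw [D'.map_smul, Submodule.coe_smul, norm_smul, norm_smul, hθn, ← mul_add]
    calc θ * (‖(ζ : H)‖ + ‖D' ζ‖) ≤ θ * (‖(ξ : H)‖ + (‖D ξ‖ + κ * ‖(ξ : H)‖)) := by gcongr
      _ ≤ θ * ((1 + κ) * (‖(ξ : H)‖ + ‖D ξ‖)) := by
        gcongr
        nlinarith [norm_nonneg (D ξ)]
      _ = _ := by rw [← mul_assoc, hθκ, one_mul]
  -- Three errors, uniform in s: truncation (Λ⁻¹), transplantation (Sκ from the phases, κ from the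
  -- vectors), rescaling (κ).
  have e1 : ‖expI D s (ξ - ∑ n ∈ F, c n • b n)‖ ≤ Λ⁻¹ * ‖D ξ‖ := by
    rw [hb.norm_expI_apply hD]
    exact hb.norm_sub_sum_le hD hΛ hF ξ
  have hS : 0 ≤ S := hs0.trans hs
  have e2 : ‖expI D s (∑ n ∈ F, c n • b n) - expI D' s ζ‖ ≤ (S * κ + κ) * ‖(ξ : H)‖ := by
    rw [hζ, map_sum, map_sum, ← Finset.sum_sub_distrib]
    refine (norm_sum_le _ _).trans (le_trans (Finset.sum_le_sum fun n _ => ?_ :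
      _ ≤ ∑ n ∈ F, (S * |lam n - lam' n| + ‖b n - b' n‖) * ‖(ξ : H)‖) ?_)
    · rw [map_smul, map_smul, ← smul_sub, norm_smul, mul_comm]
      refine mul_le_mul ?_ (hcn n) (norm_nonneg _) (by positivity)
      · rw [hb.expI_apply_basis hD, hb'.expI_apply_basis hD']
        have : Complex.exp (Complex.I * (s * lam n : ℝ)) • b n -
            Complex.exp (Complex.I * (s * lam' n : ℝ)) • b' n =
            (Complex.exp (Complex.I * (s * lam n : ℝ)) -
              Complex.exp (Complex.I * (s * lam' n : ℝ))) • b n +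
            Complex.exp (Complex.I * (s * lam' n : ℝ)) • (b n - b' n) := by
          module
        rw [this]
        refine norm_add_le_of_le ?_ ?_
        · rw [norm_smul, b.orthonormal.1, mul_one]
          refine (norm_exp_I_mul_sub_exp_I_mul_le _ _).trans ?_
          rw [← mul_sub, abs_mul, abs_of_nonneg hs0]
          gcongr
        · rw [norm_smul, Complex.norm_exp_I_mul_ofReal, one_mul]
    · rw [← Finset.sum_mul, Finset.sum_add_distrib, ← Finset.mul_sum]
      gcongr
  have e3 : ‖expI D' s ζ - expI D' s ((θ : ℂ) • (ζ : H))‖ ≤ κ * ‖(ξ : H)‖ := by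
    rw [← map_sub, hb'.norm_expI_apply hD']
    have : (ζ : H) - (θ : ℂ) • (ζ : H) = ((1 - θ : ℝ) : ℂ) • (ζ : H) := by
      push_cast
      module
    rw [this, norm_smul, Complex.norm_real, Real.norm_of_nonneg (by linarith)]
    gcongr
  have e4 : expI D s ξ - expI D' s ((θ : ℂ) • (ζ : H)) =
      expI D s (ξ - ∑ n ∈ F, c n • b n) + (expI D s (∑ n ∈ F, c n • b n) - expI D' s ζ) +
        (expI D' s ζ - expI D' s ((θ : ℂ) • (ζ : H))) := by
    rw [map_sub]
    abel
  rw [Submodule.coe_smul, e4]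
  refine (norm_add_le_of_le (norm_add_le_of_le e1 e2) e3).trans ?_
  have hΛ' : 0 ≤ Λ⁻¹ := inv_nonneg.2 hΛ.le
  have : 0 ≤ Λ⁻¹ * ‖(ξ : H)‖ := by positivity
  have : 0 ≤ (S * κ + 2 * κ) * ‖D ξ‖ := by positivity
  linarith

end Approximation

/-! ### No eigenvalue enters the window -/

section Persistence

theorem unitInterval.eventually_nhds_zero_iff {p : unitInterval → Prop} :
    (∀ᶠ t in 𝓝 (0 : unitInterval), p t) ↔ ∃ δ : ℝ, 0 < δ ∧ ∀ t : unitInterval, (t : ℝ) < δ → p t := by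
  have h : ∀ t : unitInterval, dist t 0 = t := fun t => by
    rw [Subtype.dist_eq, Real.dist_eq]
    simp [abs_of_nonneg t.2.1]
  simp only [Metric.eventually_nhds_iff, h, gt_iff_lt]

theorem exists_notMem_of_countable {s : Set ℝ} (hs : s.Countable) (a : ℝ) : ∃ x ∉ s, a < x := by
  obtain ⟨x, hx, hxa, -⟩ := (hs.dense_compl ℝ).exists_between (lt_add_one a)
  exact ⟨x, hx, hxa⟩

variable {H : Type*} [NormedAddCommGroup H] [InnerProductSpace ℂ H] [CompleteSpace H]

/-- If the number of points of the spectrum in bounded intervals is locally constant at `0`, no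
eigenvalue of large index enters a suitable large interval. -/
theorem exists_spectral_window {D : unitInterval → H →ₗ.[ℂ] H} {lam : ℕ → unitInterval → ℝ}
    {b : unitInterval → HilbertBasis ℕ ℂ H} (hD : IsSelfAdjoint (D 0))
    (hR : ∃ z R, IsResolventAt (D 0) z R ∧ IsCompactOperator R)
    (hb : ∀ t, IsEigenbasis (D t) (b t) fun n => lam n t) (hlam : ∀ n, Continuous (lam n))
    (hcard : ∀ Λ : ℝ, 0 < Λ → ∃ δ : ℝ, 0 < δ ∧ ∀ t : unitInterval, (t : ℝ) < δ →
      (unboundedSpectrum (D t) ∩ Complex.ofReal '' Set.Icc (-Λ) Λ).encard =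
        (unboundedSpectrum (D 0) ∩ Complex.ofReal '' Set.Icc (-Λ) Λ).encard)
    {Λ₀ : ℝ} (hΛ₀ : 0 < Λ₀) :
    ∃ Λ, Λ₀ < Λ ∧ ∃ F : Finset ℕ, (∀ n ∉ F, Λ < |lam n 0|) ∧
      ∀ᶠ t in 𝓝 0, ∀ n ∉ F, Λ < |lam n t| := by
  obtain ⟨z₀, R, hR, hRc⟩ := hR
  -- No eigenvalue of `D 0` may lie on the boundary of the window, so that those inside remain
  -- strictly inside for small t.
  obtain ⟨Λ, hΛn, hΛ⟩ := exists_notMem_of_countable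
    (Set.countable_range fun n => |lam n 0|) Λ₀
  have hfin := (hb 0).finite_abs_le hR hRc Λ
  have hF : ∀ n ∉ hfin.toFinset, Λ < |lam n 0| := fun n hn => by simpa using hn
  refine ⟨Λ, hΛ, hfin.toFinset, hF, ?_⟩
  set S := fun t => unboundedSpectrum (D t) ∩ Complex.ofReal '' Set.Icc (-Λ) Λ with hS
  have hmem : ∀ t n, |lam n t| ≤ Λ → (lam n t : ℂ) ∈ S t := fun t n h =>
    ⟨(hb t).mem_spectrum n, _, abs_le.1 h, rfl⟩
  have hex : ∀ z ∈ S 0, ∃ n, (lam n 0 : ℂ) = z := fun z hz =>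
    (hb 0).exists_eq_of_mem_spectrum hD hR hRc hz.1
  -- One index per point of the spectrum: the hypothesis counts points without multiplicity.
  choose! idx hidx using hex
  have hidx' : ∀ z ∈ S 0, |lam (idx z) 0| < Λ := by
    intro z hz
    obtain ⟨x, hx, hxz⟩ := hz.2
    have h1 : lam (idx z) 0 = x := Complex.ofReal_injective ((hidx z hz).trans hxz.symm)
    refine lt_of_le_of_ne ?_ fun h => hΛn ⟨_, h⟩
    rw [h1]
    exact abs_le.2 hx
  have hSfin : (S 0).Finite := by
    refine (hfin.image fun n => (lam n 0 : ℂ)).subset fun z hz => ?_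
    exact ⟨idx z, (hidx' z hz).le, hidx z hz⟩
  have ev1 : ∀ᶠ t in 𝓝 0, ∀ z ∈ S 0, |lam (idx z) t| < Λ := by
    rw [Filter.eventually_all_finite hSfin]
    exact fun z hz => (hlam _).abs.continuousAt.eventually_lt_const (hidx' z hz)
  have ev2 : ∀ᶠ t in 𝓝 0, ∀ z ∈ S 0, ∀ w ∈ S 0, z ≠ w → lam (idx z) t ≠ lam (idx w) t := by
    rw [Filter.eventually_all_finite hSfin]
    intro z hz
    rw [Filter.eventually_all_finite hSfin]
    intro w hw
    by_cases hzw : z = w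
    · simp [hzw]
    · have hne : lam (idx z) 0 ≠ lam (idx w) 0 := fun h => by
        apply hzw
        rw [← hidx z hz, ← hidx w hw, h]
      exact (((hlam _).continuousAt.ne_iff_eventually_ne (hlam _).continuousAt).1 hne).mono
        fun t ht _ => ht
  have ev3 : ∀ᶠ t in 𝓝 0, (S t).encard = (S 0).encard :=
    unitInterval.eventually_nhds_zero_iff.2 (hcard Λ (hΛ₀.trans hΛ))
  -- An eigenvalue with modulus exactly Λ would be one point more than the continuations of the
  -- points of `S 0`, which are distinct and strictly inside.
  have ev4 : ∀ᶠ t in 𝓝 0, ∀ n, |lam n t| ≠ Λ := by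
    filter_upwards [ev1, ev2, ev3] with t h1 h2 h3 n hn
    have hinj : Set.InjOn (fun z => (lam (idx z) t : ℂ)) (S 0) := by
      intro z hz w hw hzw
      by_contra hne
      exact h2 z hz w hw hne (Complex.ofReal_injective hzw)
    have hnot : (lam n t : ℂ) ∉ (fun z => (lam (idx z) t : ℂ)) '' S 0 := by
      rintro ⟨z, hz, hzn⟩
      have := h1 z hz
      rw [Complex.ofReal_injective hzn, hn] at this
      exact lt_irrefl _ this
    have hsub : insert (lam n t : ℂ) ((fun z => (lam (idx z) t : ℂ)) '' S 0) ⊆ S t := by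
      rintro _ (rfl | ⟨z, hz, rfl⟩)
      · exact hmem t n hn.le
      · exact hmem t _ (h1 z hz).le
    have := Set.encard_le_encard hsub
    rw [Set.encard_insert_of_notMem hnot, hinj.encard_image, h3] at this
    exact absurd this (not_le.2 ((ENat.lt_add_one_iff' hSfin.encard_lt_top.ne).2 le_rfl))
  obtain ⟨δ, hδ, hδ'⟩ := unitInterval.eventually_nhds_zero_iff.1 ev4
  refine unitInterval.eventually_nhds_zero_iff.2 ⟨δ, hδ, fun t ht n hn => ?_⟩
  by_contra! hle
  have hcont : ContinuousOn (fun t => |lam n t|) (Set.Icc 0 t) := (hlam n).abs.continuousOn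
  -- The crossing time r is at most t, so `ev4` forbids it. The same δ serves every n.
  obtain ⟨r, hr, hrΛ⟩ := intermediate_value_Icc' (unitInterval.nonneg' (t := t)) hcont
    ⟨hle, (hF n hn).le⟩
  exact hδ' r (lt_of_le_of_lt hr.2 ht) n hrΛ

end Persistence

/-! ### States and the extent of direct sum tunnels -/

section States

variable {A : Type*} [CStarAlgebra A]

/-- Both ‖h‖·1 - h and ‖h‖·1 + h are of the form c*c, on which φ is real and nonnegative. -/
theorem enorm_state_apply_le (φ : stateSpace A) {h : A} (hh : IsSelfAdjoint h) :
    ‖φ.1 h‖ₑ ≤ ‖h‖ₑ := by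
  let _ := CStarAlgebra.spectralOrder A
  let _ := CStarAlgebra.spectralOrderedRing A
  have key : ∀ h : A, IsSelfAdjoint h → 0 ≤ ‖h‖ - (φ.1 h).re ∧ (φ.1 h).im = 0 := by
    intro h hh
    have h1 : 0 ≤ algebraMap ℝ A ‖h‖ - h := sub_nonneg.2 hh.le_algebraMap_norm_self
    obtain ⟨c, hc⟩ := CStarAlgebra.nonneg_iff_eq_star_mul_self.1 h1
    have h2 := φ.2.2 c
    have h3 : algebraMap ℝ A ‖h‖ = (‖h‖ : ℂ) • (1 : A) := by
      rw [Algebra.algebraMap_eq_smul_one, Complex.coe_smul]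
    rw [← hc, map_sub, h3, map_smul, φ.2.1] at h2
    simpa using h2
  have h1 := key h hh
  have h2 := key (-h) hh.neg
  rw [map_neg, norm_neg, Complex.neg_re] at h2
  have h3 : φ.1 h = ((φ.1 h).re : ℂ) := Complex.ext rfl (by simpa using h1.2)
  rw [h3, enorm_le_iff_norm_le, Complex.norm_real, Real.norm_eq_abs, abs_le]
  constructor <;> linarith [h1.1, h2.1]

theorem mongeKantorovich_self (L : selfAdjoint A → ℝ≥0∞) (φ : stateSpace A) :
    mongeKantorovich L φ φ = 0 := by
  simp [mongeKantorovich]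

/-- The diagonal embedding of `A` into `A ⊕ A`. -/
def diagonalHom (A : Type*) [CStarAlgebra A] : A →⋆ₐ[ℂ] A × A :=
  StarAlgHom.prod (StarAlgHom.id ℂ A) (StarAlgHom.id ℂ A)

/-- Pulled-back states are themselves states, so the other half of the Hausdorff distance vanishes.
-/
theorem hausdorffDistance_univ_range_le {B : Type*} [CStarAlgebra B] (L : selfAdjoint A → ℝ≥0∞)
    (ρ : A →⋆ₐ[ℂ] B) {r : ℝ≥0∞} (h : ∀ φ, ∃ ψ, mongeKantorovich L φ (statePullback ρ ψ) ≤ r) :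
    hausdorffDistance (mongeKantorovich L) Set.univ (Set.range (statePullback ρ)) ≤ r := by
  refine max_le (iSup₂_le fun φ _ => ?_) (iSup₂_le fun φ _ => ?_)
  · obtain ⟨ψ, hψ⟩ := h φ
    exact (iInf₂_le _ ⟨ψ, rfl⟩).trans hψ
  · exact (iInf₂_le φ (Set.mem_univ _)).trans (by simp [mongeKantorovich_self])

theorem enorm_sub_le_of_directSumSeminorm_le {LA LB : selfAdjoint A → ℝ≥0∞} {ε : ℝ} (hε : 0 < ε)
    {c : selfAdjoint (A × A)} (hc : directSumSeminorm LA LB ε c ≤ 1) :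
    ‖(c : A × A).1 - (c : A × A).2‖ₑ ≤ ENNReal.ofReal (ε / 2) := by
  have h1 := (le_max_right _ _).trans hc
  rw [← ENNReal.ofReal_one, ENNReal.ofReal_le_ofReal_iff zero_le_one, div_mul_eq_mul_div,
    div_le_one hε] at h1
  rw [← ofReal_norm]
  exact ENNReal.ofReal_le_ofReal (by linarith)

/-- Composing φ with a diagonal changes its argument (a, b) by (a - b, 0) or (0, b - a), of norm at
most ε/2 on the unit ball. Nothing is needed about `LA` and `LB`. -/
theorem tunnelExtent_directSumSeminorm_le (LA LB : selfAdjoint A → ℝ≥0∞) {ε : ℝ} (hε : 0 < ε) :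
    tunnelExtent (directSumSeminorm LA LB ε) (StarAlgHom.snd ℂ A A) (StarAlgHom.fst ℂ A A) ≤
      ENNReal.ofReal (ε / 2) := by
  refine max_le (hausdorffDistance_univ_range_le _ _ fun φ => ?_)
    (hausdorffDistance_univ_range_le _ _ fun φ => ?_) <;>
  · refine ⟨statePullback (diagonalHom A) φ, iSup₂_le fun c hc => ?_⟩
    refine le_trans ?_ (enorm_sub_le_of_directSumSeminorm_le hε hc)
    have hc1 : IsSelfAdjoint (c : A × A).1 := congrArg Prod.fst (selfAdjoint.mem_iff.mp c.2)
    have hc2 : IsSelfAdjoint (c : A × A).2 := congrArg Prod.snd (selfAdjoint.mem_iff.mp c.2)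
    first
    | change ‖φ.1 (c : A × A) - φ.1 ((c : A × A).2, (c : A × A).2)‖ₑ ≤ _
      rw [← map_sub]
      refine (enorm_state_apply_le φ ?_).trans (le_of_eq ?_)
      · exact c.2.sub (Prod.ext hc2 hc2)
      · rw [← ofReal_norm, ← ofReal_norm, Prod.norm_def]
        simp
    | change ‖φ.1 (c : A × A) - φ.1 ((c : A × A).1, (c : A × A).1)‖ₑ ≤ _
      rw [← map_sub]
      refine (enorm_state_apply_le φ ?_).trans (le_of_eq ?_)
      · exact c.2.sub (Prod.ext hc1 hc1)
      · rw [← ofReal_norm, ← ofReal_norm, Prod.norm_def]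
        simp [norm_sub_rev]

theorem norm_realPart_fst_sub_snd_le (x : A × A) :
    ‖(realPart x : A × A).1 - (realPart x : A × A).2‖ ≤ ‖x.1 - x.2‖ := by
  have h : (realPart x : A × A).1 - (realPart x : A × A).2 = realPart (x.1 - x.2) := by
    simp only [realPart_apply_coe, Prod.smul_fst, Prod.smul_snd, Prod.fst_add, Prod.snd_add,
      Prod.fst_star, Prod.snd_star, star_sub]
    module
  rw [h]
  rw [AddSubgroup.norm_coe]
  exact realPart.norm_le (x.1 - x.2)

theorem norm_imaginaryPart_fst_sub_snd_le (x : A × A) :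
    ‖(imaginaryPart x : A × A).1 - (imaginaryPart x : A × A).2‖ ≤ ‖x.1 - x.2‖ := by
  have h : imaginaryPart x = realPart (-(Complex.I • x)) := by
    rw [map_neg, realPart_I_smul, neg_neg]
  rw [h]
  refine (norm_realPart_fst_sub_snd_le _).trans (le_of_eq ?_)
  simp [neg_add_eq_sub, ← smul_sub, norm_smul, norm_sub_rev]

end States

/-! ### The quantum compact metric space of two points -/

section TwoPoints

/-- The seminorm `(z, w) ↦ (2 / ε) |z - w|` on the self-adjoint part of `ℂ ⊕ ℂ`. -/
noncomputable def twoPointSeminorm (ε : ℝ) : selfAdjoint (ℂ × ℂ) → ℝ≥0∞ :=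
  directSumSeminorm (fun _ => 0) (fun _ => 0) ε

theorem twoPointSeminorm_apply (ε : ℝ) (c : selfAdjoint (ℂ × ℂ)) :
    twoPointSeminorm ε c = ENNReal.ofReal (2 / ε * ‖(c : ℂ × ℂ).1 - (c : ℂ × ℂ).2‖) := by
  simp [twoPointSeminorm, directSumSeminorm]

theorem stateSpace_apply_prod (φ : stateSpace (ℂ × ℂ)) (c : ℂ × ℂ) :
    φ.1 c = c.2 + (c.1 - c.2) * φ.1 (1, 0) := by
  have h : c = c.2 • (1 : ℂ × ℂ) + (c.1 - c.2) • (1, 0) := by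
    ext <;> simp
  conv_lhs => rw [h]
  rw [map_add, map_smul, map_smul, φ.2.1]
  simp

/-- A state is an affine function of its weight at (1, 0), so convergence of that weight is weak*
convergence. -/
theorem isInducing_eval_fst :
    IsInducing fun φ : stateSpace (ℂ × ℂ) => φ.1 ((1, 0) : ℂ × ℂ) := by
  rw [isInducing_iff_nhds]
  intro φ
  refine le_antisymm ?_ ?_
  · rw [← Filter.map_le_iff_le_comap]
    exact ((WeakDual.eval_continuous _).comp continuous_subtype_val).continuousAt
  · have h : Tendsto (fun ψ : stateSpace (ℂ × ℂ) => ψ.1)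
        (comap (fun ψ : stateSpace (ℂ × ℂ) => ψ.1 ((1, 0) : ℂ × ℂ)) (𝓝 (φ.1 ((1, 0) : ℂ × ℂ))))
        (𝓝 φ.1) := by
      rw [tendsto_iff_forall_eval_tendsto_topDualPairing]
      intro c
      change Tendsto (fun ψ : stateSpace (ℂ × ℂ) => ψ.1 c) _ (𝓝 (φ.1 c))
      simp_rw [stateSpace_apply_prod _ c]
      exact (tendsto_comap.const_mul _).const_add _
    rw [nhds_subtype_eq_comap]
    exact h.le_comap

/-- The supremum is attained at (ε/2, 0). -/
theorem mongeKantorovich_twoPointSeminorm {ε : ℝ} (hε : 0 < ε) (φ ψ : stateSpace (ℂ × ℂ)) :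
    mongeKantorovich (twoPointSeminorm ε) φ ψ =
      ENNReal.ofReal (ε / 2) * edist (φ.1 ((1, 0) : ℂ × ℂ)) (ψ.1 ((1, 0) : ℂ × ℂ)) := by
  have h : ∀ c : ℂ × ℂ, φ.1 c - ψ.1 c = (c.1 - c.2) * (φ.1 (1, 0) - ψ.1 (1, 0)) := by
    intro c
    rw [stateSpace_apply_prod φ c, stateSpace_apply_prod ψ c]
    ring
  rw [edist_eq_enorm_sub]
  refine le_antisymm (iSup₂_le fun c hc => ?_) ?_
  · rw [h, enorm_mul]
    gcongr
    exact enorm_sub_le_of_directSumSeminorm_le hε hc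
  · have hs : ((((ε / 2 : ℝ) : ℂ), 0) : ℂ × ℂ) ∈ selfAdjoint (ℂ × ℂ) :=
      Prod.ext (Complex.conj_ofReal _) (star_zero _)
    have hn : ‖((ε / 2 : ℝ) : ℂ)‖ = ε / 2 := by
      rw [Complex.norm_real, Real.norm_of_nonneg (by positivity)]
    refine le_trans (le_of_eq ?_) (le_iSup₂ (⟨_, hs⟩ : selfAdjoint (ℂ × ℂ)) ?_)
    · change _ = ‖φ.1 (((ε / 2 : ℝ) : ℂ), (0 : ℂ)) - ψ.1 (((ε / 2 : ℝ) : ℂ), (0 : ℂ))‖ₑ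
      rw [h (((ε / 2 : ℝ) : ℂ), (0 : ℂ)), enorm_mul, sub_zero, ← ofReal_norm ((ε / 2 : ℝ) : ℂ), hn]
    · rw [twoPointSeminorm_apply, sub_zero, hn, div_mul_div_cancel₀ hε.ne', div_self two_ne_zero,
        ENNReal.ofReal_one]

theorem metrizesWeakStar_twoPointSeminorm {ε : ℝ} (hε : 0 < ε) :
    MetrizesWeakStar (twoPointSeminorm ε) := by
  have h0 : ENNReal.ofReal (ε / 2) ≠ 0 := by
    rw [Ne, ENNReal.ofReal_eq_zero]
    linarith
  refine ⟨fun φ ψ => ?_, fun φ => ?_⟩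
  · rw [mongeKantorovich_twoPointSeminorm hε]
    exact ENNReal.mul_lt_top ENNReal.ofReal_lt_top (edist_lt_top _ _)
  · rw [isInducing_eval_fst.nhds_eq_comap]
    refine (Metric.nhds_basis_eball.comap _).to_hasBasis (fun r hr => ?_) fun r hr => ?_
    · refine ⟨ENNReal.ofReal (ε / 2) * r, ENNReal.mul_pos h0 hr.ne', fun ψ hψ => ?_⟩
      have hψ' : mongeKantorovich (twoPointSeminorm ε) φ ψ < _ := hψ
      rw [mongeKantorovich_twoPointSeminorm hε,
        ENNReal.mul_lt_mul_iff_right h0 ENNReal.ofReal_ne_top] at hψ'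
      rw [Set.mem_preimage, Metric.mem_eball, edist_comm]
      exact hψ'
    · refine ⟨(ENNReal.ofReal (ε / 2))⁻¹ * r, ENNReal.mul_pos
        (ENNReal.inv_ne_zero.2 ENNReal.ofReal_ne_top) hr.ne', fun ψ hψ => ?_⟩
      rw [Set.mem_preimage, Metric.mem_eball, edist_comm] at hψ
      change mongeKantorovich (twoPointSeminorm ε) φ ψ < r
      rw [mongeKantorovich_twoPointSeminorm hε]
      have := (ENNReal.mul_lt_mul_iff_right h0 ENNReal.ofReal_ne_top).2 hψ
      rwa [← mul_assoc, ENNReal.mul_inv_cancel h0 ENNReal.ofReal_ne_top, one_mul] at this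

theorem isQuantumIsometry_twoPointSeminorm_fst (ε : ℝ) :
    IsQuantumIsometry (twoPointSeminorm ε) (fun _ => 0) (StarAlgHom.fst ℂ ℂ ℂ) := by
  refine ⟨Prod.fst_surjective, fun a => le_antisymm zero_le ?_⟩
  have h := iInf₂_le (f := fun (c : selfAdjoint (ℂ × ℂ))
    (_ : StarAlgHom.fst ℂ ℂ ℂ (c : ℂ × ℂ) = (a : ℂ)) => twoPointSeminorm ε c)
    ⟨((a : ℂ), (a : ℂ)), Prod.ext a.2 a.2⟩ rfl
  refine h.trans (le_of_eq ?_)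
  simp [twoPointSeminorm_apply]

theorem isQuantumIsometry_twoPointSeminorm_snd (ε : ℝ) :
    IsQuantumIsometry (twoPointSeminorm ε) (fun _ => 0) (StarAlgHom.snd ℂ ℂ ℂ) := by
  refine ⟨Prod.snd_surjective, fun a => le_antisymm zero_le ?_⟩
  have h := iInf₂_le (f := fun (c : selfAdjoint (ℂ × ℂ))
    (_ : StarAlgHom.snd ℂ ℂ ℂ (c : ℂ × ℂ) = (a : ℂ)) => twoPointSeminorm ε c)
    ⟨((a : ℂ), (a : ℂ)), Prod.ext a.2 a.2⟩ rfl
  refine h.trans (le_of_eq ?_)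
  simp [twoPointSeminorm_apply]

theorem isQuantumCompactMetricSpace_twoPointSeminorm {ε : ℝ} (hε : 0 < ε) :
    IsQuantumCompactMetricSpace (twoPointSeminorm ε) := by
  have h0 : 0 < 2 / ε := by positivity
  -- Bounding the whole product ab gives both Leibniz inequalities, since taking real or imaginary
  -- parts does not increase the difference of the coordinates.
  have hmul : ∀ a b : selfAdjoint (ℂ × ℂ),
      ENNReal.ofReal (2 / ε * ‖((a : ℂ × ℂ) * b).1 - ((a : ℂ × ℂ) * b).2‖) ≤
        ‖(a : ℂ × ℂ)‖ₑ * twoPointSeminorm ε b + twoPointSeminorm ε a * ‖(b : ℂ × ℂ)‖ₑ := by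
    intro a b
    rw [twoPointSeminorm_apply, twoPointSeminorm_apply, ← ofReal_norm, ← ofReal_norm,
      ← ENNReal.ofReal_mul (norm_nonneg _), ← ENNReal.ofReal_mul (by positivity),
      ← ENNReal.ofReal_add (by positivity) (by positivity)]
    refine ENNReal.ofReal_le_ofReal ?_
    have h1 : ((a : ℂ × ℂ) * b).1 - ((a : ℂ × ℂ) * b).2 =
        (a : ℂ × ℂ).1 * ((b : ℂ × ℂ).1 - (b : ℂ × ℂ).2) +
          ((a : ℂ × ℂ).1 - (a : ℂ × ℂ).2) * (b : ℂ × ℂ).2 := by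
      rw [Prod.fst_mul, Prod.snd_mul]
      ring
    have h2 : ‖((a : ℂ × ℂ) * b).1 - ((a : ℂ × ℂ) * b).2‖ ≤
        ‖(a : ℂ × ℂ)‖ * ‖(b : ℂ × ℂ).1 - (b : ℂ × ℂ).2‖ +
          ‖(a : ℂ × ℂ).1 - (a : ℂ × ℂ).2‖ * ‖(b : ℂ × ℂ)‖ := by
      rw [h1]
      refine norm_add_le_of_le ?_ ?_
      · rw [norm_mul]
        gcongr
        exact norm_fst_le _
      · rw [norm_mul]
        gcongr
        exact norm_snd_le _
    calc _ ≤ 2 / ε * (‖(a : ℂ × ℂ)‖ * ‖(b : ℂ × ℂ).1 - (b : ℂ × ℂ).2‖ +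
          ‖(a : ℂ × ℂ).1 - (a : ℂ × ℂ).2‖ * ‖(b : ℂ × ℂ)‖) := by gcongr
      _ = _ := by ring
  refine ⟨fun a b => ?_, fun r a => ?_, ?_, fun a => ?_, ?_, fun a b => ?_, fun a b => ?_,
    metrizesWeakStar_twoPointSeminorm hε⟩
  · simp only [twoPointSeminorm_apply]
    rw [← ENNReal.ofReal_add (by positivity) (by positivity), ← mul_add]
    refine ENNReal.ofReal_le_ofReal ?_
    gcongr
    refine le_trans (le_of_eq ?_) (norm_add_le _ _)
    congr 1
    simp only [AddSubgroup.coe_add, Prod.fst_add, Prod.snd_add]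
    ring
  · simp only [twoPointSeminorm_apply]
    rw [← ofReal_norm, ← ENNReal.ofReal_mul (norm_nonneg _)]
    congr 1
    simp only [selfAdjoint.val_smul, Prod.smul_fst, Prod.smul_snd]
    rw [← smul_sub, norm_smul]
    ring
  · convert dense_univ
    ext a
    simp [twoPointSeminorm_apply]
  · rw [twoPointSeminorm_apply, ENNReal.ofReal_eq_zero]
    constructor
    · intro h
      have h1 : ‖(a : ℂ × ℂ).1 - (a : ℂ × ℂ).2‖ = 0 :=
        le_antisymm (nonpos_of_mul_nonpos_right h h0) (norm_nonneg _)
      have h2 := sub_eq_zero.1 (norm_eq_zero.1 h1)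
      have h3 : IsSelfAdjoint (a : ℂ × ℂ).1 := congrArg Prod.fst (selfAdjoint.mem_iff.mp a.2)
      refine ⟨(a : ℂ × ℂ).1.re, ?_⟩
      have h4 : ((a : ℂ × ℂ).1.re : ℂ) = (a : ℂ × ℂ).1 := Complex.conj_eq_iff_re.1 h3
      ext1
      refine Prod.ext ?_ ?_
      · simp [h4]
      · simp [← h2, h4]
    · rintro ⟨r, rfl⟩
      simp
  · refine Continuous.lowerSemicontinuous ?_
    have : twoPointSeminorm ε = fun c : selfAdjoint (ℂ × ℂ) =>
        ENNReal.ofReal (2 / ε * ‖(c : ℂ × ℂ).1 - (c : ℂ × ℂ).2‖) :=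
      funext fun c => twoPointSeminorm_apply ε c
    rw [this]
    exact ENNReal.continuous_ofReal.comp (by fun_prop)
  · refine le_trans ?_ (hmul a b)
    rw [twoPointSeminorm_apply]
    gcongr
    exact norm_realPart_fst_sub_snd_le _
  · refine le_trans ?_ (hmul a b)
    rw [twoPointSeminorm_apply]
    gcongr
    exact norm_imaginaryPart_fst_sub_snd_le _

theorem tunnelExtent_twoPointSeminorm_le {ε : ℝ} (hε : 0 < ε) :
    tunnelExtent (twoPointSeminorm ε) (StarAlgHom.snd ℂ ℂ ℂ) (StarAlgHom.fst ℂ ℂ ℂ) ≤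
      ENNReal.ofReal (ε / 2) :=
  tunnelExtent_directSumSeminorm_le (fun _ => 0) (fun _ => 0) hε

end TwoPoints

/-! ### Approximation of orbits -/

section OrbitApproximation

variable {H : Type*} [NormedAddCommGroup H] [InnerProductSpace ℂ H] [CompleteSpace H]

theorem expI_zero (D : H →ₗ.[ℂ] H) : expI D 0 = 1 := by
  by_cases h : ∃ U, IsUnitaryGroupOf D U
  · rw [expI, dif_pos h]
    exact h.choose_spec.map_zero
  · rw [expI, dif_neg h]

/-- Vectors in the domain of `D` are approximated, together with their orbits up to time `S`, by
vectors in the domain of `D'` of no larger graph norm. -/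
def OrbitApprox (D D' : H →ₗ.[ℂ] H) (S c : ℝ) : Prop :=
  ∀ ξ : D.domain, ∃ η : D'.domain, ‖(η : H)‖ + ‖D' η‖ ≤ ‖(ξ : H)‖ + ‖D ξ‖ ∧
    ∀ s, 0 ≤ s → s ≤ S → ‖expI D s ξ - expI D' s η‖ ≤ c * (‖(ξ : H)‖ + ‖D ξ‖)

/-- The orbit estimate at time zero. -/
theorem OrbitApprox.exists_graphNorm_le {D D' : H →ₗ.[ℂ] H} {S c : ℝ} (h : OrbitApprox D D' S c)
    (hS : 0 ≤ S) (ξ : D.domain) : ∃ η : H, graphNorm D' η ≤ graphNorm D (ξ : H) ∧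
      ‖(ξ : H) - η‖ ≤ c * (‖(ξ : H)‖ + ‖D ξ‖) := by
  obtain ⟨η, h1, h2⟩ := h ξ
  refine ⟨η, ?_, ?_⟩
  · rw [graphNorm_coe_eq_ofReal, graphNorm_coe_eq_ofReal]
    exact ENNReal.ofReal_le_ofReal h1
  · simpa [expI_zero] using h2 0 le_rfl hS

omit [CompleteSpace H] in
theorem norm_inner_sub_inner_le {u v x y : H} {a c : ℝ} (huv : ‖u - v‖ ≤ a) (hv : ‖v‖ ≤ 1)
    (hx : ‖x‖ ≤ 1) (hxy : ‖x - y‖ ≤ c) : ‖(inner ℂ u x : ℂ) - inner ℂ v y‖ ≤ a + c := by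
  have h : (inner ℂ u x : ℂ) - inner ℂ v y = inner ℂ (u - v) x + inner ℂ v (x - y) := by
    rw [inner_sub_left, inner_sub_right]
    ring
  have ha : 0 ≤ a := (norm_nonneg _).trans huv
  rw [h]
  refine norm_add_le_of_le ((norm_inner_le_norm _ _).trans ?_) ((norm_inner_le_norm _ _).trans ?_)
  · calc _ ≤ a * 1 := by gcongr
      _ = a := mul_one a
  · calc _ ≤ 1 * c := by gcongr
      _ = c := one_mul c

end OrbitApproximation

/-! ### Commutators and the graph norm -/

section Commutators

variable {A : Type*} [CStarAlgebra A] {H : Type*} [NormedAddCommGroup H] [InnerProductSpace ℂ H]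
  [CompleteSpace H] {π : A →⋆ₐ[ℂ] (H →L[ℂ] H)} {D : H →ₗ.[ℂ] H}

/-- The infimum defining the commutator norm is attained: for ξ ≠ 0, divide by ‖ξ‖ and pass to the
infimum. -/
theorem enorm_commutator_le {a : A} (ha : commutatorNorm π D a < ∞) (ξ : D.domain) :
    ∃ h : π a ξ ∈ D.domain,
      ‖D ⟨π a ξ, h⟩ - π a (D ξ)‖ₑ ≤ commutatorNorm π D a * ‖(ξ : H)‖ₑ := by
  obtain ⟨C, hC⟩ := iInf_lt_iff.1 ha
  obtain ⟨hC, -⟩ := iInf_lt_iff.1 hC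
  obtain ⟨h, hle⟩ := hC ξ
  refine ⟨h, ?_⟩
  rcases eq_or_ne (ξ : H) 0 with h0 | h0
  · rw [norm_eq_zero.2 h0, mul_zero] at hle
    have : ‖D ⟨π a ξ, h⟩ - π a (D ξ)‖ₑ = 0 := by
      rw [enorm_eq_zero, ← norm_eq_zero]
      exact le_antisymm hle (norm_nonneg _)
    rw [this]
    exact zero_le
  · rw [← ENNReal.div_le_iff_le_mul (Or.inl (by simpa using h0)) (Or.inl enorm_ne_top)]
    refine le_iInf₂ fun C' hC' => ?_
    rw [ENNReal.div_le_iff_le_mul (Or.inl (by simpa using h0)) (Or.inl enorm_ne_top)]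
    obtain ⟨_, hle'⟩ := hC' ξ
    rw [← ofReal_norm, ← ofReal_norm, ← ENNReal.ofReal_coe_nnreal,
      ← ENNReal.ofReal_mul C'.coe_nonneg]
    exact ENNReal.ofReal_le_ofReal hle'

/-- From Dax = [D, a]x + aDx. The degenerate cases are separate because 0 · ∞ = 0 in `ℝ≥0∞`. -/
theorem graphNorm_apply_le (a : A) (x : H) :
    graphNorm D (π a x) ≤ (‖a‖ₑ + commutatorNorm π D a) * graphNorm D x := by
  have hπ : ∀ y : H, ‖π a y‖ₑ ≤ ‖a‖ₑ * ‖y‖ₑ := fun y => by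
    rw [← ofReal_norm, ← ofReal_norm, ← ofReal_norm, ← ENNReal.ofReal_mul (norm_nonneg _)]
    refine ENNReal.ofReal_le_ofReal (((π a).le_opNorm y).trans ?_)
    gcongr
    exact NonUnitalStarAlgHom.norm_apply_le π a
  by_cases hx : x ∈ D.domain
  · rcases eq_or_ne x 0 with rfl | hx0
    · simp [graphNorm_zero]
    rcases eq_or_ne (commutatorNorm π D a) ∞ with ha | ha
    · have : graphNorm D x ≠ 0 := by
        intro h
        have := enorm_le_graphNorm (D := D) x
        rw [h, nonpos_iff_eq_zero, enorm_eq_zero] at this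
        exact hx0 this
      rw [ha, add_top, ENNReal.top_mul this]
      exact le_top
    · obtain ⟨h, hle⟩ := enorm_commutator_le (lt_top_iff_ne_top.2 ha) ⟨x, hx⟩
      have h1 := graphNorm_coe (D := D) ⟨x, hx⟩
      have h2 := graphNorm_coe (D := D) ⟨π a x, h⟩
      dsimp only at h1 h2 hle
      rw [h1, h2]
      have h3 : D ⟨π a x, h⟩ = (D ⟨π a x, h⟩ - π a (D ⟨x, hx⟩)) + π a (D ⟨x, hx⟩) := by abel
      have h4 : ‖D ⟨π a x, h⟩‖ₑ ≤
          commutatorNorm π D a * ‖x‖ₑ + ‖a‖ₑ * ‖D ⟨x, hx⟩‖ₑ := by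
        rw [h3]
        exact (enorm_add_le _ _).trans (add_le_add hle (hπ _))
      calc _ ≤ ‖a‖ₑ * ‖x‖ₑ + (commutatorNorm π D a * ‖x‖ₑ + ‖a‖ₑ * ‖D ⟨x, hx⟩‖ₑ) :=
            add_le_add (hπ _) h4
        _ = (‖a‖ₑ + commutatorNorm π D a) * ‖x‖ₑ + ‖a‖ₑ * ‖D ⟨x, hx⟩‖ₑ := by ring
        _ ≤ (‖a‖ₑ + commutatorNorm π D a) * ‖x‖ₑ +
            (‖a‖ₑ + commutatorNorm π D a) * ‖D ⟨x, hx⟩‖ₑ := by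
          gcongr
          exact le_self_add
        _ = _ := by ring
  · rw [graphNorm_of_notMem hx]
    rcases eq_or_ne a 0 with rfl | ha
    · simp [graphNorm_zero]
    · rw [ENNReal.mul_top (by simp [ha])]
      exact le_top

end Commutators

/-! ### The metrical correspondence on the direct sum -/

section DirectSum

variable {A : Type*} [CStarAlgebra A] {H : Type*} [NormedAddCommGroup H] [InnerProductSpace ℂ H]
  [CompleteSpace H]

/-- The Hilbert module `H ⊕ H` over `ℂ ⊕ ℂ`, with the diagonal action of `A ⊕ A`. -/
noncomputable def directSumCorrespondence (π : A →⋆ₐ[ℂ] (H →L[ℂ] H)) :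
    CStarCorrespondence (A × A) (ℂ × ℂ) (H × H) where
  act :=
    { toFun := fun c => LinearMap.prodMap (π c.1).toLinearMap (π c.2).toLinearMap
      map_one' := by ext <;> simp
      map_mul' := fun c d => by ext <;> simp
      map_zero' := by ext <;> simp
      map_add' := fun c d => by ext <;> simp
      commutes' := fun z => by ext <;> simp [Algebra.algebraMap_eq_smul_one] }
  rsmul x e := (e.1 • x.1, e.2 • x.2)
  inn x y := (inner ℂ x.1 y.1, inner ℂ x.2 y.2)
  inner_add_right x y z := Prod.ext (inner_add_right _ _ _) (inner_add_right _ _ _)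
  inner_smul_right x c y := Prod.ext (inner_smul_right _ _ _) (inner_smul_right _ _ _)
  inner_rsmul_right x y e := Prod.ext ((inner_smul_right _ _ _).trans (mul_comm _ _))
    ((inner_smul_right _ _ _).trans (mul_comm _ _))
  star_inner x y := Prod.ext (inner_conj_symm _ _) (inner_conj_symm _ _)
  inner_self_pos x := ⟨((‖x.1‖ : ℂ), (‖x.2‖ : ℂ)), Prod.ext
    (by simp [inner_self_eq_norm_sq_to_K, sq]) (by simp [inner_self_eq_norm_sq_to_K, sq])⟩
  norm_sq x := by
    rw [Prod.norm_def, Prod.norm_def, inner_self_eq_norm_sq_to_K, inner_self_eq_norm_sq_to_K]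
    simp only [norm_pow, RCLike.norm_ofReal, abs_norm]
    rcases le_total ‖x.1‖ ‖x.2‖ with h | h
    · rw [max_eq_right h, max_eq_right (by gcongr)]
    · rw [max_eq_left h, max_eq_left (by gcongr)]
  act_adjoint c x y := by
    have h : ∀ (a : A) (u v : H), inner ℂ (π a u) v = inner ℂ u (π (star a) v) := fun a u v => by
      rw [map_star, ContinuousLinearMap.star_eq_adjoint, ContinuousLinearMap.adjoint_inner_right]
    exact Prod.ext (h _ _ _) (h _ _ _)

/-- The D-norm `(x, y) ↦ max (DN x, DN y, (2 / ε) ‖x - y‖)` on `H ⊕ H`. -/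
noncomputable def directSumGraphNorm (D₁ D₂ : H →ₗ.[ℂ] H) (ε : ℝ) (x : H × H) : ℝ≥0∞ :=
  max (max (graphNorm D₁ x.1) (graphNorm D₂ x.2)) (ENNReal.ofReal (2 / ε * ‖x.1 - x.2‖))

variable {D₁ D₂ : H →ₗ.[ℂ] H} {ε : ℝ}

omit [CompleteSpace H] in
theorem graphNorm_fst_le (x : H × H) : graphNorm D₁ x.1 ≤ directSumGraphNorm D₁ D₂ ε x :=
  (le_max_left _ _).trans (le_max_left _ _)

omit [CompleteSpace H] in
theorem graphNorm_snd_le (x : H × H) : graphNorm D₂ x.2 ≤ directSumGraphNorm D₁ D₂ ε x :=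
  (le_max_right _ _).trans (le_max_left _ _)

omit [CompleteSpace H] in
theorem ofReal_norm_sub_le_directSumGraphNorm (x : H × H) :
    ENNReal.ofReal (2 / ε * ‖x.1 - x.2‖) ≤ directSumGraphNorm D₁ D₂ ε x :=
  le_max_right _ _

omit [CompleteSpace H] in
theorem enorm_fst_le (x : H × H) : ‖x.1‖ₑ ≤ directSumGraphNorm D₁ D₂ ε x :=
  (enorm_le_graphNorm _).trans (graphNorm_fst_le x)

omit [CompleteSpace H] in
theorem enorm_snd_le (x : H × H) : ‖x.2‖ₑ ≤ directSumGraphNorm D₁ D₂ ε x :=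
  (enorm_le_graphNorm _).trans (graphNorm_snd_le x)

omit [CompleteSpace H] in
-- The factor 2 counts the two terms of ⟨x₁ - x₂, y₁⟩ + ⟨x₂, y₁ - y₂⟩.
theorem ofReal_norm_inner_sub_inner_le (hε : 0 < ε) (x y : H × H) :
    ENNReal.ofReal (2 / ε * ‖(inner ℂ x.1 y.1 : ℂ) - inner ℂ x.2 y.2‖) ≤
      2 * directSumGraphNorm D₁ D₂ ε x * directSumGraphNorm D₁ D₂ ε y := by
  have h1 : (inner ℂ x.1 y.1 : ℂ) - inner ℂ x.2 y.2 =
      inner ℂ (x.1 - x.2) y.1 + inner ℂ x.2 (y.1 - y.2) := by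
    rw [inner_sub_left, inner_sub_right]
    ring
  have h2 : ‖(inner ℂ x.1 y.1 : ℂ) - inner ℂ x.2 y.2‖ ≤
      ‖x.1 - x.2‖ * ‖y.1‖ + ‖x.2‖ * ‖y.1 - y.2‖ := by
    rw [h1]
    exact norm_add_le_of_le (norm_inner_le_norm _ _) (norm_inner_le_norm _ _)
  have h3 : 2 / ε * ‖(inner ℂ x.1 y.1 : ℂ) - inner ℂ x.2 y.2‖ ≤
      2 / ε * ‖x.1 - x.2‖ * ‖y.1‖ + ‖x.2‖ * (2 / ε * ‖y.1 - y.2‖) := by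
    calc _ ≤ 2 / ε * (‖x.1 - x.2‖ * ‖y.1‖ + ‖x.2‖ * ‖y.1 - y.2‖) := by gcongr
      _ = _ := by ring
  refine (ENNReal.ofReal_le_ofReal h3).trans ?_
  rw [ENNReal.ofReal_add (by positivity) (by positivity), ENNReal.ofReal_mul (by positivity),
    ENNReal.ofReal_mul (norm_nonneg _), ofReal_norm, ofReal_norm, mul_assoc, two_mul]
  gcongr
  · exact ofReal_norm_sub_le_directSumGraphNorm x
  · exact enorm_fst_le y
  · exact enorm_snd_le x
  · exact ofReal_norm_sub_le_directSumGraphNorm y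

theorem directSumGraphNorm_act_le {π : A →⋆ₐ[ℂ] (H →L[ℂ] H)} (hε : 0 < ε)
    (a : selfAdjoint (A × A)) (x : H × H) :
    directSumGraphNorm D₁ D₂ ε ((directSumCorrespondence π).act a x) ≤
      (‖(a : A × A)‖ₑ + directSumSeminorm (diracSeminorm π D₁) (diracSeminorm π D₂) ε a) *
        directSumGraphNorm D₁ D₂ ε x := by
  have hn1 : ‖(a : A × A).1‖ₑ ≤ ‖(a : A × A)‖ₑ := by
    rw [← ofReal_norm, ← ofReal_norm]
    exact ENNReal.ofReal_le_ofReal (norm_fst_le _)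
  have hn2 : ‖(a : A × A).2‖ₑ ≤ ‖(a : A × A)‖ₑ := by
    rw [← ofReal_norm, ← ofReal_norm]
    exact ENNReal.ofReal_le_ofReal (norm_snd_le _)
  refine max_le (max_le ?_ ?_) ?_
  · refine (graphNorm_apply_le (π := π) (a : A × A).1 x.1).trans ?_
    gcongr
    · exact (le_max_left _ _).trans (le_max_left _ _)
    · exact graphNorm_fst_le x
  · refine (graphNorm_apply_le (π := π) (a : A × A).2 x.2).trans ?_
    gcongr
    · exact (le_max_right _ _).trans (le_max_left _ _)
    · exact graphNorm_snd_le x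
  · change ENNReal.ofReal (2 / ε * ‖π (a : A × A).1 x.1 - π (a : A × A).2 x.2‖) ≤ _
    have hπ : ∀ (b : A) (y : H), ‖π b y‖ ≤ ‖b‖ * ‖y‖ := fun b y =>
      ((π b).le_opNorm y).trans (by gcongr; exact NonUnitalStarAlgHom.norm_apply_le π b)
    -- The weight 2/ε falls on x₁ - x₂ in one term and on a₁ - a₂ in the other, matching the D-norm
    -- and the seminorm.
    have h1 : π (a : A × A).1 x.1 - π (a : A × A).2 x.2 =
        π (a : A × A).1 (x.1 - x.2) + π ((a : A × A).1 - (a : A × A).2) x.2 := by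
      rw [map_sub, map_sub, sub_apply]
      abel
    have h2 : 2 / ε * ‖π (a : A × A).1 x.1 - π (a : A × A).2 x.2‖ ≤
        ‖(a : A × A).1‖ * (2 / ε * ‖x.1 - x.2‖) +
          2 / ε * ‖(a : A × A).1 - (a : A × A).2‖ * ‖x.2‖ := by
      calc _ ≤ 2 / ε * (‖(a : A × A).1‖ * ‖x.1 - x.2‖ +
            ‖(a : A × A).1 - (a : A × A).2‖ * ‖x.2‖) := by
            gcongr
            rw [h1]
            exact norm_add_le_of_le (hπ _ _) (hπ _ _)
        _ = _ := by ring
    refine (ENNReal.ofReal_le_ofReal h2).trans ?_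
    rw [ENNReal.ofReal_add (by positivity) (by positivity), ENNReal.ofReal_mul (norm_nonneg _),
      ENNReal.ofReal_mul (by positivity : 0 ≤ 2 / ε * ‖(a : A × A).1 - (a : A × A).2‖),
      ofReal_norm, ofReal_norm, add_mul]
    gcongr
    · exact ofReal_norm_sub_le_directSumGraphNorm x
    · exact le_max_right _ _
    · exact enorm_snd_le x

theorem isMetricalCorrespondence_directSum {π : A →⋆ₐ[ℂ] (H →L[ℂ] H)} (hε : 0 < ε)
    (h₁ : IsSpectralTriple π D₁) (h₂ : IsSpectralTriple π D₂)
    (hq : IsQuantumCompactMetricSpace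
      (directSumSeminorm (diracSeminorm π D₁) (diracSeminorm π D₂) ε)) :
    IsMetricalCorrespondence (directSumCorrespondence π) (directSumGraphNorm D₁ D₂ ε)
      (directSumSeminorm (diracSeminorm π D₁) (diracSeminorm π D₂) ε) (twoPointSeminorm ε) where
  qcms_left := hq
  qcms_base := isQuantumCompactMetricSpace_twoPointSeminorm hε
  add_le x y := by
    refine max_le (max_le ?_ ?_) ?_
    · exact (graphNorm_add_le _ _).trans (add_le_add (graphNorm_fst_le x) (graphNorm_fst_le y))
    · exact (graphNorm_add_le _ _).trans (add_le_add (graphNorm_snd_le x) (graphNorm_snd_le y))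
    · refine le_trans ?_ (add_le_add (ofReal_norm_sub_le_directSumGraphNorm x)
        (ofReal_norm_sub_le_directSumGraphNorm y))
      rw [← ENNReal.ofReal_add (by positivity) (by positivity), ← mul_add]
      refine ENNReal.ofReal_le_ofReal ?_
      gcongr
      refine le_trans (le_of_eq ?_) (norm_add_le _ _)
      congr 1
      rw [Prod.fst_add, Prod.snd_add]
      abel
  smul c x := by
    simp only [directSumGraphNorm, Prod.smul_fst, Prod.smul_snd, graphNorm_smul, mul_max]
    congr 1
    rw [← smul_sub, norm_smul, ← ofReal_norm c, ← ENNReal.ofReal_mul (norm_nonneg _)]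
    congr 1
    ring
  dense_dom := by
    refine (h₁.isSelfAdjoint.dense_domain.prod h₂.isSelfAdjoint.dense_domain).mono ?_
    rintro ⟨x, y⟩ ⟨hx, hy⟩
    refine max_lt (max_lt ?_ ?_) ENNReal.ofReal_lt_top
    · rw [graphNorm_coe_eq_ofReal (D := D₁) ⟨x, hx⟩]
      exact ENNReal.ofReal_lt_top
    · rw [graphNorm_coe_eq_ofReal (D := D₂) ⟨y, hy⟩]
      exact ENNReal.ofReal_lt_top
  norm_le x := by
    rw [← ofReal_norm, Prod.norm_def]
    rcases max_choice ‖x.1‖ ‖x.2‖ with h | h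
    · rw [h, ofReal_norm]
      exact enorm_fst_le x
    · rw [h, ofReal_norm]
      exact enorm_snd_le x
  isCompact_ball := by
    obtain ⟨z₁, R₁, hR₁, hc₁⟩ := h₁.compact_resolvent
    obtain ⟨z₂, R₂, hR₂, hc₂⟩ := h₂.compact_resolvent
    have h : {x | directSumGraphNorm D₁ D₂ ε x ≤ 1} =
        ({x | graphNorm D₁ x ≤ 1} ×ˢ {y | graphNorm D₂ y ≤ 1}) ∩
          {x | ENNReal.ofReal (2 / ε * ‖x.1 - x.2‖) ≤ 1} := by
      ext x
      simp [directSumGraphNorm]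
    rw [h]
    refine ((isCompact_graphNorm_le h₁.isSelfAdjoint hR₁ hc₁).prod
      (isCompact_graphNorm_le h₂.isSelfAdjoint hR₂ hc₂)).inter_right ?_
    exact isClosed_le (ENNReal.continuous_ofReal.comp (by fun_prop)) continuous_const
  inner_leibniz_re x y := by
    refine le_trans ?_ (ofReal_norm_inner_sub_inner_le hε x y)
    rw [twoPointSeminorm_apply]
    gcongr
    exact norm_realPart_fst_sub_snd_le _
  inner_leibniz_im x y := by
    refine le_trans ?_ (ofReal_norm_inner_sub_inner_le hε x y)
    rw [twoPointSeminorm_apply]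
    gcongr
    exact norm_imaginaryPart_fst_sub_snd_le _
  modular_leibniz a x := directSumGraphNorm_act_le hε a x

/-- The constant ε/2 exactly offsets the weight 2/ε, so the pair (ξ, η) has D-norm no larger than
the graph norm of ξ. -/
theorem OrbitApprox.exists_ofReal_norm_sub_le {D D' : H →ₗ.[ℂ] H} {S : ℝ} (hε : 0 < ε) (hS : 0 ≤ S)
    (h : OrbitApprox D D' S (ε / 2)) {ξ : H} (hξ : ξ ∈ D.domain) :
    ∃ η, graphNorm D' η ≤ graphNorm D ξ ∧
      ENNReal.ofReal (2 / ε * ‖ξ - η‖) ≤ graphNorm D ξ := by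
  obtain ⟨η, h1, h2⟩ := h.exists_graphNorm_le hS ⟨ξ, hξ⟩
  refine ⟨η, h1, ?_⟩
  rw [graphNorm_coe_eq_ofReal (D := D) ⟨ξ, hξ⟩]
  refine ENNReal.ofReal_le_ofReal ?_
  calc 2 / ε * ‖ξ - η‖ ≤ 2 / ε * (ε / 2 * (‖ξ‖ + ‖D ⟨ξ, hξ⟩‖)) := by gcongr
    _ = _ := by field_simp

theorem isMetricalIsometry_fst {π : A →⋆ₐ[ℂ] (H →L[ℂ] H)} {S : ℝ} (hε : 0 < ε) (hS : 0 ≤ S)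
    (hq : IsQuantumIsometry (directSumSeminorm (diracSeminorm π D₁) (diracSeminorm π D₂) ε)
      (diracSeminorm π D₁) (StarAlgHom.fst ℂ A A))
    (h : OrbitApprox D₁ D₂ S (ε / 2)) :
    IsMetricalIsometry (directSumCorrespondence π) (directSumGraphNorm D₁ D₂ ε)
      (directSumSeminorm (diracSeminorm π D₁) (diracSeminorm π D₂) ε) (twoPointSeminorm ε) π D₁
      (StarAlgHom.fst ℂ A A) (LinearMap.fst ℂ H H) (StarAlgHom.fst ℂ ℂ ℂ) where
  left := hq
  base := isQuantumIsometry_twoPointSeminorm_fst ε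
  surjective := Prod.fst_surjective
  map_act _ _ := rfl
  map_rsmul _ _ := rfl
  map_inner _ _ := rfl
  quotient ξ := by
    refine le_antisymm (le_iInf₂ fun x hx => ?_) ?_
    · rw [← hx]
      exact graphNorm_fst_le x
    · by_cases hξ : ξ ∈ D₁.domain
      · obtain ⟨η, h1, h2⟩ := OrbitApprox.exists_ofReal_norm_sub_le hε hS h hξ
        exact iInf₂_le_of_le ((ξ, η) : H × H) rfl (max_le (max_le le_rfl h1) h2)
      · rw [graphNorm_of_notMem hξ]
        exact le_top

theorem isMetricalIsometry_snd {π : A →⋆ₐ[ℂ] (H →L[ℂ] H)} {S : ℝ} (hε : 0 < ε) (hS : 0 ≤ S)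
    (hq : IsQuantumIsometry (directSumSeminorm (diracSeminorm π D₁) (diracSeminorm π D₂) ε)
      (diracSeminorm π D₂) (StarAlgHom.snd ℂ A A))
    (h : OrbitApprox D₂ D₁ S (ε / 2)) :
    IsMetricalIsometry (directSumCorrespondence π) (directSumGraphNorm D₁ D₂ ε)
      (directSumSeminorm (diracSeminorm π D₁) (diracSeminorm π D₂) ε) (twoPointSeminorm ε) π D₂
      (StarAlgHom.snd ℂ A A) (LinearMap.snd ℂ H H) (StarAlgHom.snd ℂ ℂ ℂ) where
  left := hq
  base := isQuantumIsometry_twoPointSeminorm_snd ε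
  surjective := Prod.snd_surjective
  map_act _ _ := rfl
  map_rsmul _ _ := rfl
  map_inner _ _ := rfl
  quotient ξ := by
    refine le_antisymm (le_iInf₂ fun x hx => ?_) ?_
    · rw [← hx]
      exact graphNorm_snd_le x
    · by_cases hξ : ξ ∈ D₂.domain
      · obtain ⟨η, h1, h2⟩ := OrbitApprox.exists_ofReal_norm_sub_le hε hS h hξ
        rw [norm_sub_rev] at h2
        exact iInf₂_le_of_le ((η, ξ) : H × H) rfl (max_le (max_le h1 le_rfl) h2)
      · rw [graphNorm_of_notMem hξ]
        exact le_top

end DirectSum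

/-! ### Extent and separation of the metrical tunnel -/

section Tunnel

variable {A : Type u} [CStarAlgebra A] {H : Type v} [NormedAddCommGroup H] [InnerProductSpace ℂ H]
  [CompleteSpace H] {π : A →⋆ₐ[ℂ] (H →L[ℂ] H)} {D₁ D₂ : H →ₗ.[ℂ] H} {ε S : ℝ}

/-- The metrical tunnel on `A ⊕ A`, `ℂ ⊕ ℂ` and `H ⊕ H`. -/
noncomputable def directSumTunnel (hε : 0 < ε) (hS : 0 ≤ S)
    (h₁ : IsSpectralTriple π D₁) (h₂ : IsSpectralTriple π D₂)
    (hτ : IsTunnel (directSumSeminorm (diracSeminorm π D₁) (diracSeminorm π D₂) ε)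
      (diracSeminorm π D₁) (diracSeminorm π D₂) (StarAlgHom.fst ℂ A A) (StarAlgHom.snd ℂ A A))
    (h₁₂ : OrbitApprox D₁ D₂ S (ε / 2)) (h₂₁ : OrbitApprox D₂ D₁ S (ε / 2)) :
    MetricalTunnel π D₂ π D₁ where
  𝔇 := A × A
  𝔈 := ℂ × ℂ
  E := H × H
  M := directSumCorrespondence π
  TN := directSumGraphNorm D₁ D₂ ε
  LD := directSumSeminorm (diracSeminorm π D₁) (diracSeminorm π D₂) ε
  LE := twoPointSeminorm ε
  isMetrical := isMetricalCorrespondence_directSum hε h₁ h₂ hτ.qcms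
  -- The given tunnel goes from `D₁` to `D₂`; the projections are exchanged to reverse it.
  ρA := StarAlgHom.snd ℂ A A
  ρB := StarAlgHom.fst ℂ A A
  PA := LinearMap.snd ℂ H H
  PB := LinearMap.fst ℂ H H
  jA := StarAlgHom.snd ℂ ℂ ℂ
  jB := StarAlgHom.fst ℂ ℂ ℂ
  isometry_left := isMetricalIsometry_snd hε hS hτ.right h₂₁
  isometry_right := isMetricalIsometry_fst hε hS hτ.left h₁₂

theorem extent_directSumTunnel_le (hε : 0 < ε) (hS : 0 ≤ S)
    (h₁ : IsSpectralTriple π D₁) (h₂ : IsSpectralTriple π D₂)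
    (hτ : IsTunnel (directSumSeminorm (diracSeminorm π D₁) (diracSeminorm π D₂) ε)
      (diracSeminorm π D₁) (diracSeminorm π D₂) (StarAlgHom.fst ℂ A A) (StarAlgHom.snd ℂ A A))
    (h₁₂ : OrbitApprox D₁ D₂ S (ε / 2)) (h₂₁ : OrbitApprox D₂ D₁ S (ε / 2)) :
    (directSumTunnel hε hS h₁ h₂ hτ h₁₂ h₂₁).extent ≤ ENNReal.ofReal (ε / 2) :=
  max_le (tunnelExtent_directSumSeminorm_le (diracSeminorm π D₁) (diracSeminorm π D₂) hε)
    (tunnelExtent_twoPointSeminorm_le hε)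

/-- Half of ε comes from the orbits, half from the distance between the coordinates of ω. -/
theorem orbitDistance_directSumTunnel_le (hε : 0 < ε) (hS : 0 ≤ S)
    (h₁ : IsSpectralTriple π D₁) (h₂ : IsSpectralTriple π D₂)
    (hτ : IsTunnel (directSumSeminorm (diracSeminorm π D₁) (diracSeminorm π D₂) ε)
      (diracSeminorm π D₁) (diracSeminorm π D₂) (StarAlgHom.fst ℂ A A) (StarAlgHom.snd ℂ A A))
    (h₁₂ : OrbitApprox D₁ D₂ S (ε / 2)) (h₂₁ : OrbitApprox D₂ D₁ S (ε / 2)) {r : ℝ≥0}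
    {ξ η : H} (h : ∀ s, 0 ≤ s → s ≤ 1 / (r : ℝ) →
      ‖expI D₂ s ξ - expI D₁ s η‖ ≤ ε / 2 ∧ ‖expI D₁ s η‖ ≤ 1) :
    (directSumTunnel hε hS h₁ h₂ hτ h₁₂ h₂₁).orbitDistance r ξ η ≤ ENNReal.ofReal ε := by
  refine iSup₂_le fun s hs => iSup₂_le fun (ω : H × H) hω => ?_
  have hω' : directSumGraphNorm D₁ D₂ ε ω ≤ 1 := hω
  change ‖(inner ℂ (expI D₂ s ξ) ω.2 : ℂ) - inner ℂ (expI D₁ s η) ω.1‖ₑ ≤ _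
  have h1 : ‖ω.2‖ ≤ 1 := by
    have := (enorm_snd_le ω).trans hω'
    rwa [← ofReal_norm, ← ENNReal.ofReal_one, ENNReal.ofReal_le_ofReal_iff zero_le_one] at this
  have h2 : ‖ω.2 - ω.1‖ ≤ ε / 2 := by
    have := (ofReal_norm_sub_le_directSumGraphNorm ω).trans hω'
    rw [← ENNReal.ofReal_one, ENNReal.ofReal_le_ofReal_iff zero_le_one, div_mul_eq_mul_div,
      div_le_one hε] at this
    rw [norm_sub_rev]
    linarith
  rw [← ofReal_norm]
  refine ENNReal.ofReal_le_ofReal ?_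
  have := norm_inner_sub_inner_le (h s hs.1 hs.2).1 (h s hs.1 hs.2).2 h1 h2
  linarith

theorem separation_directSumTunnel_le {r : ℝ≥0} (hε : 0 < ε) (hS : 0 ≤ S)
    (h₁ : IsSpectralTriple π D₁) (h₂ : IsSpectralTriple π D₂)
    (hτ : IsTunnel (directSumSeminorm (diracSeminorm π D₁) (diracSeminorm π D₂) ε)
      (diracSeminorm π D₁) (diracSeminorm π D₂) (StarAlgHom.fst ℂ A A) (StarAlgHom.snd ℂ A A))
    (h₁₂ : OrbitApprox D₁ D₂ S (ε / 2)) (h₂₁ : OrbitApprox D₂ D₁ S (ε / 2))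
    (hrS : 1 / (r : ℝ) ≤ S) (hexp : ∀ s x, ‖expI D₁ s x‖ ≤ ‖x‖) :
    (directSumTunnel hε hS h₁ h₂ hτ h₁₂ h₂₁).separation r ≤ ENNReal.ofReal ε := by
  have hball : ∀ {D : H →ₗ.[ℂ] H} {x : H}, graphNorm D x ≤ 1 ↔
      ∃ h : x ∈ D.domain, ‖x‖ + ‖D ⟨x, h⟩‖ ≤ 1 := fun {D x} => by
    rw [← graphNorm_le_iff zero_le_one, ENNReal.ofReal_one]
  refine max_le (iSup₂_le fun ξ hξ => ?_) (iSup₂_le fun η hη => ?_)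
  · obtain ⟨hm, hn⟩ := hball.1 hξ
    obtain ⟨η, hη1, hη2⟩ := h₂₁ ⟨ξ, hm⟩
    have hη : ‖(η : H)‖ + ‖D₁ η‖ ≤ 1 := hη1.trans hn
    refine iInf₂_le_of_le (η : H) (hball.2 ⟨η.2, hη⟩)
      (orbitDistance_directSumTunnel_le hε hS h₁ h₂ hτ h₁₂ h₂₁ fun s hs0 hs => ⟨?_, ?_⟩)
    · refine (hη2 s hs0 (hs.trans hrS)).trans ?_
      calc _ ≤ ε / 2 * 1 := by gcongr
        _ = _ := mul_one _
    · exact (hexp s _).trans (by linarith [norm_nonneg (D₁ η)])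
  · obtain ⟨hm, hn⟩ := hball.1 hη
    obtain ⟨ξ, hξ1, hξ2⟩ := h₁₂ ⟨η, hm⟩
    refine iInf₂_le_of_le (ξ : H) (hball.2 ⟨ξ.2, hξ1.trans hn⟩)
      (orbitDistance_directSumTunnel_le hε hS h₁ h₂ hτ h₁₂ h₂₁ fun s hs0 hs => ⟨?_, ?_⟩)
    · rw [norm_sub_rev]
      refine (hξ2 s hs0 (hs.trans hrS)).trans ?_
      calc _ ≤ ε / 2 * 1 := by gcongr
        _ = _ := mul_one _
    · exact (hexp s _).trans (by linarith [norm_nonneg (D₁ ⟨η, hm⟩)])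

/-- With ε = r/2 the extent is at most r/4 and the separation at most r/2, which leaves room for the
strict inequality. -/
theorem spectralPropinquity_le {r : ℝ≥0} (hr : 0 < r)
    (h₁ : IsSpectralTriple π D₁) (h₂ : IsSpectralTriple π D₂)
    (hτ : IsTunnel (directSumSeminorm (diracSeminorm π D₁) (diracSeminorm π D₂) (r / 2))
      (diracSeminorm π D₁) (diracSeminorm π D₂) (StarAlgHom.fst ℂ A A) (StarAlgHom.snd ℂ A A))
    (h₁₂ : OrbitApprox D₁ D₂ (1 / r) (r / 4)) (h₂₁ : OrbitApprox D₂ D₁ (1 / r) (r / 4))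
    (hexp : ∀ s x, ‖expI D₁ s x‖ ≤ ‖x‖) : spectralPropinquity π D₂ π D₁ ≤ r := by
  have hr' : (0 : ℝ) < r := hr
  have hlt : ∀ x : ℝ, x < r → ENNReal.ofReal x < r := fun x hx => by
    rw [← ENNReal.ofReal_coe_nnreal]
    exact (ENNReal.ofReal_lt_ofReal_iff hr').2 hx
  have hq : (r : ℝ) / 4 = r / 2 / 2 := by ring
  rw [hq] at h₁₂ h₂₁
  refine iInf₂_le r ⟨hr, directSumTunnel (by positivity) (by positivity) h₁ h₂ hτ h₁₂ h₂₁, ?_⟩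
  refine max_lt ?_ ?_
  · exact (extent_directSumTunnel_le _ _ h₁ h₂ hτ h₁₂ h₂₁).trans_lt (hlt _ (by linarith))
  · exact (separation_directSumTunnel_le _ _ h₁ h₂ hτ h₁₂ h₂₁ le_rfl hexp).trans_lt
      (hlt _ (by linarith))

end Tunnel

/-! ### Convergence of the spectral triples -/

theorem theorem2p1 {A : Type u} [CStarAlgebra A] [TopologicalSpace.SeparableSpace A]
    {H : Type v} [NormedAddCommGroup H] [InnerProductSpace ℂ H] [CompleteSpace H]
    (π : A →⋆ₐ[ℂ] (H →L[ℂ] H)) (D : unitInterval → H →ₗ.[ℂ] H)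
    (hD : ∀ t, IsMetricSpectralTriple π (D t))
    (htunnel : ∀ ε : ℝ, 0 < ε → ∃ δ : ℝ, 0 < δ ∧ ∀ t : unitInterval, (t : ℝ) < δ →
      IsTunnel (directSumSeminorm (diracSeminorm π (D 0)) (diracSeminorm π (D t)) ε)
        (diracSeminorm π (D 0)) (diracSeminorm π (D t))
        (StarAlgHom.fst ℂ A A) (StarAlgHom.snd ℂ A A))
    (heigen : ∃ (lam : ℕ → unitInterval → ℝ) (e : ℕ → unitInterval → H),
      (∀ n, Continuous (lam n)) ∧ (∀ n, Continuous (e n)) ∧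
      (∀ t, ∃ b : HilbertBasis ℕ ℂ H, ∀ n, b n = e n t) ∧
      (∀ n t, ∃ h : e n t ∈ (D t).domain, D t ⟨e n t, h⟩ = (lam n t : ℂ) • e n t) ∧
      ∀ Λ : ℝ, 0 < Λ → ∃ δ : ℝ, 0 < δ ∧ ∀ t : unitInterval, (t : ℝ) < δ →
        (unboundedSpectrum (D t) ∩ Complex.ofReal '' Set.Icc (-Λ) Λ).encard =
          (unboundedSpectrum (D 0) ∩ Complex.ofReal '' Set.Icc (-Λ) Λ).encard) :
    Tendsto (fun t => spectralPropinquity π (D t) π (D 0)) (𝓝 0) (𝓝 0) := by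
  obtain ⟨lam, e, hlam, he, hbasis, heig, hcard⟩ := heigen
  choose b hbe using hbasis
  have hb : ∀ t, IsEigenbasis (D t) (b t) fun n => lam n t := by
    intro t n
    rw [hbe t n]
    exact heig n t
  rw [ENNReal.tendsto_nhds_zero]
  intro ρ hρ
  obtain ⟨r, hr0, hrρ⟩ := ENNReal.lt_iff_exists_nnreal_btwn.1 hρ
  have hr : 0 < r := by exact_mod_cast hr0
  have hr' : (0 : ℝ) < r := hr
  -- The error budget is r/4. The threshold 8/r keeps truncation below r/8, and κ is chosen so that
  -- (1/r + 2)κ is the other r/8.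
  obtain ⟨Λ, hΛ, F, hF0, hFt⟩ := exists_spectral_window (hD 0).isSelfAdjoint
    (hD 0).compact_resolvent hb hlam hcard (by positivity : 0 < 8 / (r : ℝ))
  have hΛ0 : 0 < Λ := lt_trans (by positivity) hΛ
  have hΛr : Λ⁻¹ ≤ r / 8 := by
    rw [← inv_div]
    exact inv_anti₀ (by positivity) hΛ.le
  set κ : ℝ := r / 8 / (1 / r + 2) with hκ
  have hκ0 : 0 < κ := by positivity
  have hκr : Λ⁻¹ + 1 / r * κ + 2 * κ ≤ r / 4 := by
    have : (1 / (r : ℝ) + 2) * κ = r / 8 := mul_div_cancel₀ _ (by positivity)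
    linarith
  have ev1 : ∀ᶠ t in 𝓝 (0 : unitInterval), ∑ n ∈ F, |lam n t - lam n 0| < κ := by
    have hc : Continuous fun t => ∑ n ∈ F, |lam n t - lam n 0| :=
      continuous_finsetSum _ fun n _ => ((hlam n).sub continuous_const).abs
    exact hc.continuousAt.eventually_lt_const (by simpa using hκ0)
  have ev2 : ∀ᶠ t in 𝓝 (0 : unitInterval), ∑ n ∈ F, ‖e n t - e n 0‖ < κ := by
    have hc : Continuous fun t => ∑ n ∈ F, ‖e n t - e n 0‖ :=
      continuous_finsetSum _ fun n _ => ((he n).sub continuous_const).norm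
    exact hc.continuousAt.eventually_lt_const (by simpa using hκ0)
  have ev3 := unitInterval.eventually_nhds_zero_iff.2 (htunnel (r / 2) (by positivity))
  filter_upwards [hFt, ev1, ev2, ev3] with t h1 h2 h3 h4
  refine (spectralPropinquity_le hr (hD 0).toIsSpectralTriple (hD t).toIsSpectralTriple h4
    ?_ ?_ fun s x => ((hb 0).norm_expI_apply (hD 0).isSelfAdjoint s x).le).trans hrρ.le
  · intro ξ
    obtain ⟨η, hη, hs⟩ := (hb 0).exists_approx (hD 0).isSelfAdjoint (hb t) (hD t).isSelfAdjoint
      (F := F) (κ := κ) (S := 1 / r) hΛ0 (fun n hn => (hF0 n hn).le)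
      (by simpa only [abs_sub_comm] using h2.le)
      (by simpa only [hbe, norm_sub_rev] using h3.le) ξ
    exact ⟨η, hη, fun s hs0 hsS => (hs s hs0 hsS).trans (by gcongr)⟩
  -- Here the truncated expansion is that of `D t`, so the window at time t is what bounds the tail.
  · intro ξ
    obtain ⟨η, hη, hs⟩ := (hb t).exists_approx (hD t).isSelfAdjoint (hb 0) (hD 0).isSelfAdjoint
      (F := F) (κ := κ) (S := 1 / r) hΛ0 (fun n hn => (h1 n hn).le) h2.le
      (by simpa only [hbe] using h3.le) ξ
    exact ⟨η, hη, fun s hs0 hsS => (hs s hs0 hsS).trans (by gcongr)⟩
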